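/- For a natural number $m$, real functions $h_1,\dots,h_m$ on $(0,\infty)$ and a random multiset of $m$ points of $(0,\infty)$, we say that the points are a polynomial ensemble with functions $h_1,\dots,h_m$ if the integrals $\int_0^\infty x^{j-1}h_k(x)\,dx$ $(j,k=1,\dots,m)$ converge absolutely and, for some normalization constant $Z\neq 0$, the function $$\frac1{Z}\,\Delta_m(x)\,\det\big[h_k(x_j)\big]_{j,k=1}^m,\qquad \Delta_m(x)=\prod_{j<k}(x_k-x_j),\qquad x\in(0,\infty)^m,$$ is nonnegative on $(0,\infty)^m$, has integral $1$, and is the joint probability density of the (unordered) points. Let $n,\nu\ge 1$ be integers. Let $v=(v_1,\dots,v_{n+\nu})^t$ be a random vector such that $\operatorname{Re}v_j,\operatorname{Im}v_j$, $j=1,\dots,n+\nu$, are mutually independent normal random variables with mean $0$ and variance $1/2$. Let $X$ be a random $(n+\nu)\times(n+\nu)$ positive semidefinite Hermitian matrix, independent of $v$, which has exactly $n$ positive eigenvalues (counted with multiplicity) $x_1,\dots,x_n$, and suppose that these are a polynomial ensemble with functions $f_1,\dots,f_n$. Then, almost surely, $Y=X+vv^*$ has zero as an eigenvalue of multiplicity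 $\nu-1$ (that is, $Y$ is invertible if $\nu=1$) and $n+1$ positive eigenvalues $y_1,\dots,y_{n+1}$ (counted with multiplicity). Moreover, for every fixed $c\in(0,\infty)$, the integrals below converge for all $y>0$, and $y_1,\dots,y_{n+1}$ are a polynomial ensemble with the functions $$g_1(y)=y^{\nu-1}e^{-y},\qquad g_{k+1}(y)=y^{\nu-1}e^{-y}\int_c^y x^{-\nu}e^{x}f_k(x)\,dx\quad(k=1,\dots,n),\qquad y>0.$$ -/

import Mathlib

open MeasureTheory ProbabilityTheory
open scoped ComplexOrder

noncomputable section

/-- The Vandermonde determinant `Δ_n(x) = ∏_{j < k} (x_k - x_j)`. -/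
def vandermondeProd {n : ℕ} (x : Fin n → ℝ) : ℝ :=
  ∏ j : Fin n, ∏ k ∈ Finset.Ioi j, (x k - x j)

/-- The function `(1 / Z) Δ_n(x) det [f_k(x_j)]_{j,k=1}^n` on `ℝⁿ`. -/
def polyEnsembleDensity {n : ℕ} (Z : ℝ) (f : Fin n → ℝ → ℝ) (x : Fin n → ℝ) : ℝ :=
  1 / Z * vandermondeProd x * (Matrix.of fun j k : Fin n => f k (x j)).det

/-- The random finite multiset `M` of real numbers consists of `n` unordered points of `S` whose
joint density on `Sⁿ` is `P` (with respect to Lebesgue measure, no order being imposed on the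
points): for every permutation-invariant Borel set `B ⊆ ℝⁿ`, the probability that the points,
listed in some order (equivalently, in any order), give an element of `B` is `∫_{B ∩ Sⁿ} P`. -/
def HasUnorderedDensity {Ω : Type*} [MeasurableSpace Ω] (μ : Measure Ω) {n : ℕ} (S : Set ℝ)
    (M : Ω → Multiset ℝ) (P : (Fin n → ℝ) → ℝ) : Prop :=
  ∀ B : Set (Fin n → ℝ), MeasurableSet B →
    (∀ σ : Equiv.Perm (Fin n), ∀ x ∈ B, x ∘ σ ∈ B) →
      μ {ω | ∃ x ∈ B, (Finset.univ : Finset (Fin n)).val.map x = M ω} =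
        ∫⁻ x in B ∩ {x | ∀ j, x j ∈ S}, ENNReal.ofReal (P x)

/-- The points of the random multiset `M` are a polynomial ensemble on `S` with functions
`f_1, …, f_n`: the integrals of `x^{j-1} f_k(x)` over `S` converge, and for some normalization
constant `Z` the function `(1 / Z) Δ_n(x) det [f_k(x_j)]` is a probability density on `Sⁿ`
(nonnegative everywhere on `Sⁿ`, of total mass one, which forces `Z ≠ 0`) and is the joint density
of the points of `M`. -/
def IsPolynomialEnsemble {Ω : Type*} [MeasurableSpace Ω] (μ : Measure Ω) {n : ℕ} (S : Set ℝ)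
    (f : Fin n → ℝ → ℝ) (M : Ω → Multiset ℝ) : Prop :=
  (∀ j k : Fin n, IntegrableOn (fun x : ℝ => x ^ (j : ℕ) * f k x) S) ∧
    ∃ Z : ℝ,
      (∀ x : Fin n → ℝ, (∀ j, x j ∈ S) → 0 ≤ polyEnsembleDensity Z f x) ∧
      (∫⁻ x in {x : Fin n → ℝ | ∀ j, x j ∈ S}, ENNReal.ofReal (polyEnsembleDensity Z f x)) = 1 ∧
      HasUnorderedDensity μ S M (polyEnsembleDensity Z f)

/-- The multiset of positive eigenvalues of a complex square matrix, each repeated according to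
its algebraic multiplicity. -/
def posEigenvalues {m : ℕ} (A : Matrix (Fin m) (Fin m) ℂ) : Multiset ℝ :=
  (A.charpoly.roots.filter fun z : ℂ => 0 < z.re ∧ z.im = 0).map Complex.re

/-- `v` is a random vector in `ℂᵐ` for which the `2m` random variables `Re v_j`, `Im v_j` are
mutually independent normal variables with mean `0` and variance `1/2`. -/
def IsStdComplexGaussianVector {Ω : Type*} [MeasurableSpace Ω] (μ : Measure Ω) {m : ℕ}
    (v : Ω → Fin m → ℂ) : Prop :=
  (∀ j, HasLaw (fun ω => (v ω j).re) (gaussianReal 0 (1 / 2)) μ) ∧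
  (∀ j, HasLaw (fun ω => (v ω j).im) (gaussianReal 0 (1 / 2)) μ) ∧
  iIndepFun (fun (p : Fin m ⊕ Fin m) (ω : Ω) =>
    Sum.elim (fun j => (v ω j).re) (fun j => (v ω j).im) p) μ

/-- `X + v v*`. -/
def rankOneModification {m : ℕ} (X : Matrix (Fin m) (Fin m) ℂ) (v : Fin m → ℂ) :
    Matrix (Fin m) (Fin m) ℂ :=
  X + Matrix.vecMulVec v (star v)

/-- The functions `g_1(y) = y^{ν-1} e^{-y}` and
`g_{k+1}(y) = y^{ν-1} e^{-y} ∫_c^y x^{-ν} e^x f_k(x) dx` for `k = 1, …, n`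
(used for `ν ≥ 1`, `c > 0` and `y > 0`). -/
def rankOneFunctions {n : ℕ} (ν : ℕ) (c : ℝ) (f : Fin n → ℝ → ℝ) : Fin (n + 1) → ℝ → ℝ :=
  Fin.cons (fun y => y ^ (ν - 1) * Real.exp (-y))
    (fun k y => y ^ (ν - 1) * Real.exp (-y) *
      ∫ x in c..y, x ^ (-(ν : ℤ)) * Real.exp x * f k x)

end

-- Diagonalize X = U D U*, where D has diagonal entries x and ν zeros. The Gaussian law is unitarily
-- invariant (`map_unitary_pi_complexGaussian`), so given X the spectrum of X + vv* has the law of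
-- that of D + uu* with u Gaussian. By the matrix determinant lemma the characteristic polynomial of
-- D + uu* is T^(ν-1) times the numerator of 1 - ∑ p_j / (T - a_j), with nodes a = (0, x) and
-- weights p. Here p_0 is the squared norm of u on the kernel of D, and the other p_j are the
-- remaining |u_j|² (`charpoly_diagonal_append_add_vecMulVec`). The weights are independent, p_0
-- being Gamma(ν) and the others exponential (`map_groupedWeights_pi_complexGaussian`).
--
-- For positive weights the roots y strictly interlace with the nodes, and p ↦ y is a bijection onto
-- the interlacing tuples. Its inverse `secularWeight a` is explicit, with Jacobian Δ(y)/Δ(a)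
-- (`abs_det_secularJacobian`). Since p_0 = ∏ y / ∏ x and ∑ p = ∑ y - ∑ x, the ordered y have, given
-- x, the density `rankOneKernel` (`pi_complexGaussian_hasSpectrumIn`).
--
-- Multiply this by the density of x. Because Δ(0, x) = ∏ x · Δ(x), the Vandermonde factor in x
-- cancels, leaving a function of y times det[x_j^(-ν) e^(x_j) f_k(x_j)]. For fixed ordered y,
-- interlacing says that x lies in the box of intervals (y_j, y_(j+1)), so the determinant
-- integrates row by row to det[G_k(y_(j+1)) - G_k(y_j)], G_k being the integral in g_(k+1).
-- Bordering by a column of ones turns this into the determinant of the g_k (`det_cons_one`,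
-- `setLIntegral_rankOneKernel_mul`).
--
-- Two matters remain. Ordered and unordered points are related by symmetrization, which avoids a
-- measurable choice of eigenvalues; it accounts for the factor n + 1 in the new constant Z (ν-1)!
-- (n+1). The moments of the g_k follow from Tonelli and an exponential tail bound
-- (`integrableOn_pow_mul_rankOneFunctions`).

-- Interlacing and the secular equation: definitions and positivity of the weights.

open Polynomial in
/-- The monic real polynomial with roots `y`. -/
noncomputable def rootPoly {m : ℕ} (y : Fin m → ℝ) : ℝ[X] := ∏ i, (X - C (y i))

/-- The points `y` interlace with the nodes `a`: `a_0 < y_0 < a_1 < y_1 < … < y_{m-1}`. -/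
def Interlaces {m : ℕ} (a y : Fin m → ℝ) : Prop :=
  (∀ i, a i < y i) ∧ ∀ i j, i < j → y i < a j

/-- The weights `p` for which `1 - ∑ p_j / (T - a_j)` has zeros `y` and poles `a`. -/
noncomputable def secularWeight {m : ℕ} (a y : Fin m → ℝ) (j : Fin m) : ℝ :=
  -(∏ i, (a j - y i)) / ∏ k ∈ Finset.univ.erase j, (a j - a k)

open Polynomial in
/-- The numerator of `1 - ∑ p_j / (T - a_j)`. -/
noncomputable def secularPoly {m : ℕ} (a p : Fin m → ℝ) : ℝ[X] :=
  rootPoly a - ∑ j, C (p j) * ∏ k ∈ Finset.univ.erase j, (X - C (a k))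

namespace Interlaces

variable {m : ℕ} {a y : Fin m → ℝ}

theorem strictMono_left (h : Interlaces a y) : StrictMono a :=
  fun i j hij => (h.1 i).trans (h.2 i j hij)

theorem strictMono_right (h : Interlaces a y) : StrictMono y :=
  fun i j hij => (h.2 i j hij).trans (h.1 j)

/-- Pair the factor a_j - y_i with a_j - a_i for i ≠ j: interlacing puts a_i and y_i on the same
side of a_j, so each ratio is positive. The unpaired factor, with the leading minus sign, is y_j -
a_j. -/
theorem secularWeight_pos (h : Interlaces a y) (j : Fin m) : 0 < secularWeight a y j := by
  have hj := Finset.mul_prod_erase Finset.univ (fun i => a j - y i) (Finset.mem_univ j)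
  rw [secularWeight, ← hj, ← neg_mul, neg_sub, mul_div_assoc, ← Finset.prod_div_distrib]
  refine mul_pos (sub_pos.2 (h.1 j)) (Finset.prod_pos fun i hi => ?_)
  rcases lt_or_gt_of_ne (Finset.ne_of_mem_erase hi) with hij | hij
  · exact div_pos (sub_pos.2 (h.2 i j hij)) (sub_pos.2 (h.strictMono_left hij))
  · exact div_pos_of_neg_of_neg (sub_neg.2 ((h.strictMono_left hij).trans (h.1 i)))
      (sub_neg.2 (h.strictMono_left hij))

end Interlaces

-- The bijection between positive weights and interlacing roots.

section Secular

open Polynomial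

variable {m : ℕ}

theorem rootPoly_monic (y : Fin m → ℝ) : (rootPoly y).Monic := monic_prod_X_sub_C _ _

theorem natDegree_rootPoly (y : Fin m → ℝ) : (rootPoly y).natDegree = m := by
  simp [rootPoly]

theorem roots_rootPoly (y : Fin m → ℝ) :
    (rootPoly y).roots = (Finset.univ : Finset (Fin m)).val.map y := by
  rw [rootPoly, Polynomial.roots_prod _ _ (Finset.prod_ne_zero_iff.2 fun i _ => X_sub_C_ne_zero _)]
  simp

theorem strictMono_eq_of_map_eq {x y : Fin m → ℝ} (hx : StrictMono x) (hy : StrictMono y)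
    (h : (Finset.univ : Finset (Fin m)).val.map x = (Finset.univ : Finset (Fin m)).val.map y) :
    x = y := by
  have hr : Set.range x = Set.range y := by
    ext t
    have := congrArg (fun s => t ∈ s) h
    simpa using this
  exact (hx.range_inj hy).1 hr

theorem rootPoly_injOn : Set.InjOn (rootPoly (m := m)) {y | StrictMono y} := by
  intro x hx y hy h
  apply strictMono_eq_of_map_eq hx hy
  rw [← roots_rootPoly, ← roots_rootPoly, h]

theorem eval_rootPoly (y : Fin m → ℝ) (t : ℝ) : (rootPoly y).eval t = ∏ i, (t - y i) := by
  simp [rootPoly, eval_prod]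

theorem eval_secularPoly (a p : Fin m → ℝ) (j : Fin m) :
    (secularPoly a p).eval (a j) = -(p j * ∏ k ∈ Finset.univ.erase j, (a j - a k)) := by
  rw [secularPoly, eval_sub, eval_rootPoly, Finset.prod_eq_zero (Finset.mem_univ j) (sub_self _),
    eval_finsetSum, Finset.sum_eq_single j]
  · simp [eval_prod]
  · intro i _ hij
    rw [eval_mul, eval_prod, Finset.prod_eq_zero (i := j)]
    · simp
    · simp [hij.symm]
    · simp
  · simp

theorem degree_secularSum_lt (a p : Fin m → ℝ) :
    (∑ j, C (p j) * ∏ k ∈ Finset.univ.erase j, (X - C (a k))).degree < (m : WithBot ℕ) := by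
  rw [degree_lt_iff_coeff_zero]
  intro d hd
  rw [finsetSum_coeff]
  refine Finset.sum_eq_zero fun j _ => ?_
  rw [coeff_C_mul, coeff_eq_zero_of_natDegree_lt, mul_zero]
  rw [natDegree_prod_of_monic _ _ (fun i _ => monic_X_sub_C _)]
  have : 0 < m := j.pos
  simp
  omega

theorem degree_secularSum_lt_rootPoly (a p : Fin m → ℝ) :
    (∑ j, C (p j) * ∏ k ∈ Finset.univ.erase j, (X - C (a k))).degree < (rootPoly a).degree := by
  rw [degree_eq_natDegree (rootPoly_monic a).ne_zero, natDegree_rootPoly]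
  exact degree_secularSum_lt a p

theorem secularPoly_monic (a p : Fin m → ℝ) : (secularPoly a p).Monic :=
  (rootPoly_monic a).sub_of_left (degree_secularSum_lt_rootPoly a p)

theorem natDegree_secularPoly (a p : Fin m → ℝ) : (secularPoly a p).natDegree = m := by
  exact (natDegree_eq_of_degree_eq (degree_sub_eq_left_of_degree_lt
    (degree_secularSum_lt_rootPoly a p))).trans (natDegree_rootPoly a)

/-- Both polynomials are monic of degree m, so their difference has degree below m and cannot vanish
at m distinct points unless it is zero. -/
theorem secularPoly_eq_rootPoly_of_eval_eq {a p y z : Fin m → ℝ} (hz : Function.Injective z)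
    (h : ∀ j, (secularPoly a p).eval (z j) = (rootPoly y).eval (z j)) :
    secularPoly a p = rootPoly y := by
  refine eq_of_degree_sub_lt_of_eval_index_eq (s := Finset.univ) (v := z) hz.injOn ?_
    fun j _ => h j
  rw [Finset.card_univ, Fintype.card_fin]
  have h := degree_sub_lt_left (p := secularPoly a p) (q := rootPoly y)
    (by rw [degree_eq_natDegree (secularPoly_monic _ _).ne_zero,
      degree_eq_natDegree (rootPoly_monic _).ne_zero, natDegree_secularPoly, natDegree_rootPoly])
    (secularPoly_monic _ _).ne_zero
    (by rw [(secularPoly_monic _ _).leadingCoeff, (rootPoly_monic _).leadingCoeff])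
  rwa [degree_eq_natDegree (secularPoly_monic _ _).ne_zero, natDegree_secularPoly] at h

theorem prod_erase_sub_ne_zero {a : Fin m → ℝ} (ha : Function.Injective a) (j : Fin m) :
    ∏ k ∈ Finset.univ.erase j, (a j - a k) ≠ 0 :=
  Finset.prod_ne_zero_iff.2 fun _ hk => sub_ne_zero.2 (ha.ne (Finset.ne_of_mem_erase hk).symm)

theorem secularPoly_secularWeight {a : Fin m → ℝ} (ha : Function.Injective a) (y : Fin m → ℝ) :
    secularPoly a (secularWeight a y) = rootPoly y := by
  refine secularPoly_eq_rootPoly_of_eval_eq ha fun j => ?_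
  rw [eval_secularPoly, eval_rootPoly, secularWeight,
    div_mul_cancel₀ _ (prod_erase_sub_ne_zero ha j), neg_neg]

theorem secularWeight_eq_of_secularPoly_eq {a p y : Fin m → ℝ} (ha : Function.Injective a)
    (h : secularPoly a p = rootPoly y) : secularWeight a y = p := by
  funext j
  have := congrArg (eval (a j)) h
  rw [eval_secularPoly, eval_rootPoly] at this
  rw [secularWeight, ← this, neg_neg, mul_div_cancel_right₀ _ (prod_erase_sub_ne_zero ha j)]

/-- Compare the coefficients of T^(m-1) in `secularPoly_secularWeight`. This turns the exponential
factor of the weight density into a function of y and a. -/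
theorem sum_secularWeight {a : Fin m → ℝ} (ha : Function.Injective a) (y : Fin m → ℝ) :
    ∑ j, secularWeight a y j = ∑ i, y i - ∑ j, a j := by
  rcases Nat.eq_zero_or_pos m with rfl | hm
  · simp
  have h := congrArg (fun q => coeff q (m - 1)) (secularPoly_secularWeight ha y)
  have hc : ∀ z : Fin m → ℝ, (rootPoly z).coeff (m - 1) = -∑ i, z i := fun z => by
    have := prod_X_sub_C_nextCoeff (s := (Finset.univ : Finset (Fin m))) z
    rwa [nextCoeff_of_natDegree_pos, ← rootPoly, natDegree_rootPoly] at this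
    rw [← rootPoly, natDegree_rootPoly]; exact hm
  have he : ∀ j : Fin m, (∏ k ∈ Finset.univ.erase j, (X - C (a k))).coeff (m - 1) = 1 := fun j => by
    have := (monic_prod_X_sub_C a (Finset.univ.erase j)).coeff_natDegree
    rwa [natDegree_prod_of_monic _ _ (fun i _ => monic_X_sub_C _),
      Finset.sum_congr rfl (fun i _ => natDegree_X_sub_C _), Finset.sum_const,
      Finset.card_erase_of_mem (Finset.mem_univ j), Finset.card_univ, Fintype.card_fin,
      smul_eq_mul, mul_one] at this
  simp only [secularPoly, coeff_sub, finsetSum_coeff, coeff_C_mul, he, hc, mul_one] at h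
  linarith

theorem neg_one_pow_mul_prod_erase_pos {a : Fin m → ℝ} (ha : StrictMono a) (j : Fin m) :
    0 < (-1) ^ (m - 1 - j) * ∏ k ∈ Finset.univ.erase j, (a j - a k) := by
  have hd : (Finset.univ.erase j : Finset (Fin m)) = Finset.Iio j ∪ Finset.Ioi j := by
    ext k; simp [lt_or_lt_iff_ne]
  rw [hd, Finset.prod_union]
  · have : ∏ k ∈ Finset.Ioi j, (a j - a k) = (-1) ^ (m - 1 - j) * ∏ k ∈ Finset.Ioi j, (a k - a j) := by
      rw [← Fin.card_Ioi, ← Finset.prod_const, ← Finset.prod_mul_distrib]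
      exact Finset.prod_congr rfl fun k _ => by ring
    rw [this, mul_left_comm, ← mul_assoc ((-1 : ℝ) ^ _), ← mul_pow]
    simp only [mul_neg, mul_one, neg_neg, one_pow, one_mul]
    exact mul_pos (Finset.prod_pos fun k hk => sub_pos.2 (ha (Finset.mem_Iio.1 hk)))
      (Finset.prod_pos fun k hk => sub_pos.2 (ha (Finset.mem_Ioi.1 hk)))
  · rw [Finset.disjoint_left]
    intro k hk hk'
    exact lt_asymm (Finset.mem_Iio.1 hk) (Finset.mem_Ioi.1 hk')

/-- Intermediate value theorem: the polynomial alternates in sign along the nodes, which gives a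
root in each gap, and its leading coefficient gives one beyond the last node. -/
theorem exists_interlaces_secularPoly_eq {a p : Fin m → ℝ} (ha : StrictMono a) (hp : ∀ j, 0 < p j) :
    ∃ y, Interlaces a y ∧ secularPoly a p = rootPoly y := by
  set q := secularPoly a p with hq
  -- At the node a_j only the j-th term of the sum survives, and m - 1 - j of the differences a_j -
  -- a_k are negative.
  have hs : ∀ j : Fin m, (-1) ^ (m - 1 - j) * q.eval (a j) < 0 := fun j => by
    rw [hq, eval_secularPoly]
    nlinarith [mul_pos (hp j) (neg_one_pow_mul_prod_erase_pos ha j)]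
  have hroot : ∀ i : Fin m, ∃ t, q.eval t = 0 ∧ a i < t ∧ ∀ j, i < j → t < a j := fun i => by
    by_cases hi : (i : ℕ) + 1 < m
    · have h1 := hs i
      have h2 := hs ⟨i + 1, hi⟩
      have hlt : a i < a ⟨i + 1, hi⟩ := ha (Fin.lt_def.2 (Nat.lt_succ_self _))
      have he : m - 1 - (i : ℕ) = (m - 1 - (i + 1)) + 1 := by omega
      rw [he, pow_succ] at h1
      simp only at h2
      set s : ℝ := (-1) ^ (m - 1 - ((i : ℕ) + 1))
      have hc : ContinuousOn (fun t => s * q.eval t) (Set.Icc (a i) (a ⟨i + 1, hi⟩)) :=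
        (continuous_const.mul q.continuous).continuousOn
      obtain ⟨t, ht, h0⟩ := intermediate_value_Ioo' hlt.le hc
        (show (0 : ℝ) ∈ Set.Ioo _ _ from ⟨h2, by linarith⟩)
      refine ⟨t, ?_, ht.1, fun j hj => ht.2.trans_le (ha.monotone (Fin.le_def.2 hj))⟩
      exact (mul_eq_zero.1 h0).resolve_left (pow_ne_zero _ (by norm_num))
    -- Last node: the value there is negative and the polynomial tends to +∞.
    · have h1 := hs i
      have he : m - 1 - (i : ℕ) = 0 := by omega
      rw [he, pow_zero, one_mul] at h1
      have htop : Filter.Tendsto (fun t => q.eval t) Filter.atTop Filter.atTop := by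
        refine q.tendsto_atTop_of_leadingCoeff_nonneg ?_ ?_
        · rw [degree_eq_natDegree (secularPoly_monic _ _).ne_zero, natDegree_secularPoly]
          exact_mod_cast i.pos
        · rw [(secularPoly_monic _ _).leadingCoeff]; exact zero_le_one
      obtain ⟨b, hb0, hb⟩ := ((htop.eventually_gt_atTop 0).and
        (Filter.eventually_gt_atTop (a i))).exists
      obtain ⟨t, ht, h0⟩ := intermediate_value_Ioo hb.le q.continuous.continuousOn
        (show (0 : ℝ) ∈ Set.Ioo _ _ from ⟨h1, hb0⟩)
      refine ⟨t, h0, ht.1, fun j hj => ?_⟩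
      have := Fin.lt_def.1 hj
      omega
  choose y hy0 hy1 hy2 using hroot
  have hI : Interlaces a y := ⟨hy1, hy2⟩
  refine ⟨y, hI, ?_⟩
  refine secularPoly_eq_rootPoly_of_eval_eq hI.strictMono_right.injective fun j => ?_
  rw [← hq, hy0, eval_rootPoly, Finset.prod_eq_zero (Finset.mem_univ j) (sub_self _)]

theorem secularWeight_injOn (a : Fin m → ℝ) : Set.InjOn (secularWeight a) {y | Interlaces a y} := by
  intro x hx y hy h
  have ha := (Interlaces.strictMono_left hx).injective
  refine rootPoly_injOn (Interlaces.strictMono_right hx) (Interlaces.strictMono_right hy) ?_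
  rw [← secularPoly_secularWeight ha, h, secularPoly_secularWeight ha]

/-- The signs of numerator and denominator at the node 0 cancel. This weight is the only one that
enters the density through a power. -/
theorem secularWeight_cons_zero {n : ℕ} (x : Fin n → ℝ) (y : Fin (n + 1) → ℝ) :
    secularWeight (Fin.cons 0 x : Fin (n + 1) → ℝ) y 0 = (∏ i, y i) / ∏ j, x j := by
  have he : (Finset.univ.erase (0 : Fin (n + 1))) = Finset.univ.map (Fin.succEmb n) := by
    ext k
    simp only [Finset.mem_erase, Finset.mem_univ, and_true, Finset.mem_map, true_and]
    exact Fin.exists_succ_eq.symm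
  rw [secularWeight, he, Finset.prod_map]
  simp only [Fin.cons_zero, zero_sub, Finset.prod_neg, Finset.card_univ, Fintype.card_fin,
    Fin.coe_succEmb, Fin.cons_succ]
  rw [pow_succ, mul_neg_one, neg_mul, neg_neg]
  exact mul_div_mul_left _ _ (pow_ne_zero _ (by norm_num))

end Secular

-- Vandermonde identities behind the Jacobian.

section Vandermonde

open Polynomial

variable {m : ℕ}

theorem det_vandermonde_eq_vandermondeProd (x : Fin m → ℝ) :
    (Matrix.vandermonde x).det = vandermondeProd x := Matrix.det_vandermonde x

theorem vandermondeProd_pos {x : Fin m → ℝ} (hx : StrictMono x) : 0 < vandermondeProd x :=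
  Finset.prod_pos fun _ _ => Finset.prod_pos fun _ hk => sub_pos.2 (hx (Finset.mem_Ioi.1 hk))

theorem vandermondeProd_eq_zero {x : Fin m → ℝ} (hx : ¬ Function.Injective x) :
    vandermondeProd x = 0 := by
  rw [← det_vandermonde_eq_vandermondeProd]
  by_contra h
  exact hx (Matrix.det_vandermonde_ne_zero_iff.1 h)

theorem vandermondeProd_comp_perm (x : Fin m → ℝ) (σ : Equiv.Perm (Fin m)) :
    vandermondeProd (x ∘ σ) = (Equiv.Perm.sign σ : ℤ) * vandermondeProd x := by
  rw [← det_vandermonde_eq_vandermondeProd, ← det_vandermonde_eq_vandermondeProd,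
    ← Matrix.det_permute]
  rfl

theorem vandermondeProd_cons_zero {n : ℕ} (x : Fin n → ℝ) :
    vandermondeProd (Fin.cons 0 x : Fin (n + 1) → ℝ) = (∏ j, x j) * vandermondeProd x := by
  simp only [vandermondeProd, Fin.prod_univ_succ (n := n), Fin.prod_Ioi_zero, Fin.prod_Ioi_succ,
    Fin.cons_zero, Fin.cons_succ, sub_zero]

theorem prod_prod_erase_abs (x : Fin m → ℝ) :
    ∏ j, ∏ k ∈ Finset.univ.erase j, |x j - x k| = |vandermondeProd x| ^ 2 := by
  have hd : ∀ j : Fin m, (Finset.univ.erase j : Finset (Fin m)) = Finset.Iio j ∪ Finset.Ioi j := by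
    intro j; ext k; simp [lt_or_lt_iff_ne]
  have h1 : ∏ j, ∏ k ∈ Finset.univ.erase j, |x j - x k| =
      (∏ j : Fin m, ∏ k ∈ Finset.Iio j, |x j - x k|) * ∏ j : Fin m, ∏ k ∈ Finset.Ioi j, |x j - x k| := by
    rw [← Finset.prod_mul_distrib]
    refine Finset.prod_congr rfl fun j _ => ?_
    rw [hd, Finset.prod_union]
    rw [Finset.disjoint_left]
    intro k hk hk'
    exact lt_asymm (Finset.mem_Iio.1 hk) (Finset.mem_Ioi.1 hk')
  have h2 : ∏ j : Fin m, ∏ k ∈ Finset.Ioi j, |x j - x k| = |vandermondeProd x| := by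
    simp only [vandermondeProd, Finset.abs_prod]
    exact Finset.prod_congr rfl fun j _ => Finset.prod_congr rfl fun k _ => abs_sub_comm _ _
  have h3 : ∏ j : Fin m, ∏ k ∈ Finset.Iio j, |x j - x k| = |vandermondeProd x| := by
    simp only [vandermondeProd, Finset.abs_prod]
    rw [Finset.prod_comm' (t' := Finset.univ) (s' := fun k => Finset.Ioi k)]
    intro j k; simp
  rw [h1, h2, h3, sq]

/-- The determinant of the matrix with entries `∏_{l ≠ i} (a_j - y_l)`, in absolute value. -/
theorem abs_det_prod_erase_sub (a y : Fin m → ℝ) (hy : Function.Injective y) :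
    |(Matrix.of fun j i : Fin m => ∏ l ∈ Finset.univ.erase i, (a j - y l)).det| =
      |vandermondeProd a| * |vandermondeProd y| := by
  set q : Fin m → ℝ[X] := fun i => ∏ l ∈ Finset.univ.erase i, (X - C (y l)) with hq
  have hdeg : ∀ i, (q i).natDegree < m := fun i => by
    rw [hq, natDegree_prod_of_monic _ _ (fun i _ => monic_X_sub_C _)]
    have := i.pos
    simp
    omega
  set N : Matrix (Fin m) (Fin m) ℝ := Matrix.of fun d i => (q i).coeff d
  -- The entries are values at z_j of polynomials that do not depend on z, so the matrix is a
  -- Vandermonde matrix times a fixed coefficient matrix N.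
  have hfac : ∀ z : Fin m → ℝ, (Matrix.of fun j i : Fin m => ∏ l ∈ Finset.univ.erase i, (z j - y l)) =
      Matrix.vandermonde z * N := fun z => by
    ext j i
    rw [Matrix.mul_apply, Matrix.of_apply]
    have : ∏ l ∈ Finset.univ.erase i, (z j - y l) = (q i).eval (z j) := by simp [hq, eval_prod]
    rw [this, eval_eq_sum_range' (hdeg i), Finset.sum_range]
    exact Finset.sum_congr rfl fun d _ => by simp [N, Matrix.vandermonde_apply, mul_comm]
  have hV : |vandermondeProd y| ≠ 0 := by
    rw [← det_vandermonde_eq_vandermondeProd, abs_ne_zero]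
    exact Matrix.det_vandermonde_ne_zero_iff.2 hy
  -- Taking z = y makes the matrix diagonal, which determines |det N| = |Δ(y)|.
  have hyy : |(Matrix.of fun j i : Fin m => ∏ l ∈ Finset.univ.erase i, (y j - y l)).det| =
      |vandermondeProd y| ^ 2 := by
    have hdiag : (Matrix.of fun j i : Fin m => ∏ l ∈ Finset.univ.erase i, (y j - y l)) =
        Matrix.diagonal fun j => ∏ l ∈ Finset.univ.erase j, (y j - y l) := by
      ext j i
      rw [Matrix.of_apply, Matrix.diagonal_apply]
      split_ifs with hji
      · rw [hji]
      · exact Finset.prod_eq_zero (Finset.mem_erase.2 ⟨hji, Finset.mem_univ j⟩) (sub_self _)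
    rw [hdiag, Matrix.det_diagonal, Finset.abs_prod, ← prod_prod_erase_abs]
    exact Finset.prod_congr rfl fun j _ => Finset.abs_prod _ _
  rw [hfac, Matrix.det_mul, abs_mul, det_vandermonde_eq_vandermondeProd] at hyy ⊢
  rw [sq] at hyy
  rw [mul_left_cancel₀ hV hyy]

end Vandermonde

-- Change of variables from weights to roots.

section ChangeOfVariables

variable {m : ℕ}

/-- The Jacobian matrix of `secularWeight a` at `y`. -/
noncomputable def secularJacobian (a y : Fin m → ℝ) : Matrix (Fin m) (Fin m) ℝ :=
  Matrix.of fun j i =>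
    (∏ k ∈ Finset.univ.erase j, (a j - a k))⁻¹ * ∏ l ∈ Finset.univ.erase i, (a j - y l)

theorem hasFDerivAt_secularWeight (a y : Fin m → ℝ) :
    HasFDerivAt (secularWeight a) (LinearMap.toContinuousLinearMap
      (Matrix.toLin' (secularJacobian a y))) y := by
  rw [hasFDerivAt_pi']
  intro j
  have h := HasFDerivAt.finsetProd (𝕜 := ℝ) (u := Finset.univ) (x := y)
    (g := fun i (z : Fin m → ℝ) => a j - z i)
    (g' := fun i => -(ContinuousLinearMap.proj i : (Fin m → ℝ) →L[ℝ] ℝ))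
    (fun i _ => (hasFDerivAt_apply i y).const_sub (a j))
  have h2 := (h.neg).mul_const (∏ k ∈ Finset.univ.erase j, (a j - a k))⁻¹
  refine HasFDerivAt.congr_fderiv (h2.congr_of_eventuallyEq (Filter.Eventually.of_forall fun z => ?_)) ?_
  · simp [secularWeight, div_eq_mul_inv]
  · ext v
    simp only [secularJacobian, ContinuousLinearMap.comp_apply, ContinuousLinearMap.proj_apply,
      LinearMap.coe_toContinuousLinearMap', Matrix.toLin'_apply, Matrix.mulVec, dotProduct,
      Matrix.of_apply, smul_neg, Finset.sum_neg_distrib, neg_neg, _root_.smul_apply,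
      _root_.sum_apply, smul_eq_mul, Finset.mul_sum, mul_assoc]

/-- The row factors contribute Δ(a)^(-2) and the remaining determinant is ±Δ(a)Δ(y). -/
theorem abs_det_secularJacobian {a y : Fin m → ℝ} (h : Interlaces a y) :
    |(secularJacobian a y).det| = vandermondeProd y / vandermondeProd a := by
  have ha := vandermondeProd_pos h.strictMono_left
  have hy := vandermondeProd_pos h.strictMono_right
  have he : (secularJacobian a y).det = (∏ j, (∏ k ∈ Finset.univ.erase j, (a j - a k))⁻¹) *
      (Matrix.of fun j i : Fin m => ∏ l ∈ Finset.univ.erase i, (a j - y l)).det :=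
    Matrix.det_mul_column _ _
  rw [he, abs_mul, abs_det_prod_erase_sub a y h.strictMono_right.injective, Finset.abs_prod,
    Finset.prod_congr rfl (fun j _ => abs_inv _), Finset.prod_inv_distrib,
    Finset.prod_congr rfl (fun j _ => Finset.abs_prod _ _), prod_prod_erase_abs,
    abs_of_pos ha, abs_of_pos hy]
  field_simp

theorem lintegral_image_secularWeight {a : Fin m → ℝ} {s : Set (Fin m → ℝ)}
    (hs : MeasurableSet s) (hsa : s ⊆ {y | Interlaces a y}) (g : (Fin m → ℝ) → ENNReal) :
    ∫⁻ p in secularWeight a '' s, g p =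
      ∫⁻ y in s, ENNReal.ofReal (vandermondeProd y / vandermondeProd a) * g (secularWeight a y) := by
  rw [lintegral_image_eq_lintegral_abs_det_fderiv_mul volume hs
    (fun y _ => (hasFDerivAt_secularWeight a y).hasFDerivWithinAt)
    ((secularWeight_injOn a).mono hsa) g]
  refine setLIntegral_congr_fun hs fun y hy => ?_
  rw [ContinuousLinearMap.det, LinearMap.coe_toContinuousLinearMap, LinearMap.det_toLin',
    abs_det_secularJacobian (hsa hy)]

/-- Lusin–Souslin: a continuous injective image of a Borel set is Borel. -/
theorem measurableSet_image_secularWeight {a : Fin m → ℝ} {s : Set (Fin m → ℝ)}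
    (hs : MeasurableSet s) (hsa : s ⊆ {y | Interlaces a y}) :
    MeasurableSet (secularWeight a '' s) :=
  hs.image_of_continuousOn_injOn
    (fun y _ => (hasFDerivAt_secularWeight a y).continuousAt.continuousWithinAt)
    ((secularWeight_injOn a).mono hsa)

end ChangeOfVariables

-- Characteristic polynomial of a diagonal matrix plus a rank one matrix.

section Charpoly

open Polynomial

theorem charpoly_diagonal_add_vecMulVec {ι : Type*} [Fintype ι] [DecidableEq ι] (d : ι → ℝ)
    (w : ι → ℂ) :
    (Matrix.diagonal (fun i => (d i : ℂ)) + Matrix.vecMulVec w (star w)).charpoly =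
      (∏ i, (X - C (d i)) - ∑ i, C (Complex.normSq (w i)) *
        ∏ k ∈ Finset.univ.erase i, (X - C (d k)) : ℝ[X]).map Complex.ofRealHom := by
  apply eq_of_infinite_eval_eq
  -- Off the finitely many diagonal entries t - D is invertible, so the matrix determinant lemma
  -- applies; agreement at infinitely many t suffices.
  refine Set.Infinite.mono (s := (Set.range fun i => (d i : ℂ))ᶜ) (fun t ht => ?_)
    (Set.finite_range _).infinite_compl
  have hne : ∀ i, t - d i ≠ 0 := fun i h => ht ⟨i, (sub_eq_zero.1 h).symm⟩
  have hM : Matrix.scalar ι t - (Matrix.diagonal (fun i => (d i : ℂ)) + Matrix.vecMulVec w (star w)) =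
      Matrix.diagonal (fun i => t - d i) +
        Matrix.replicateCol Unit (-w) * Matrix.replicateRow Unit (star w) := by
    ext i j
    simp [Matrix.vecMulVec_apply, Matrix.mul_apply, Matrix.diagonal_apply]
    split_ifs <;> ring
  have hdet : (Matrix.diagonal (fun i => t - (d i : ℂ))).det = ∏ i, (t - d i) :=
    Matrix.det_diagonal
  have hu : IsUnit (Matrix.diagonal (fun i => t - (d i : ℂ))).det := by
    rw [hdet]; exact (Finset.prod_ne_zero_iff.2 fun i _ => hne i).isUnit
  have hinv : (Matrix.diagonal (fun i => t - (d i : ℂ)))⁻¹ =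
      Matrix.diagonal (fun i => (t - (d i : ℂ))⁻¹) := by
    apply Matrix.inv_eq_right_inv
    rw [Matrix.diagonal_mul_diagonal, ← Matrix.diagonal_one]
    congr 1; funext i; exact mul_inv_cancel₀ (hne i)
  rw [Set.mem_ofPred_eq, Matrix.eval_charpoly, hM, Matrix.det_add_replicateCol_mul_replicateRow hu,
    hinv, hdet, Matrix.det_unique]
  simp only [Polynomial.map_sub, Polynomial.map_prod, Polynomial.map_sum, Polynomial.map_mul,
    map_X, map_C, eval_sub, eval_prod, eval_finsetSum, eval_mul, eval_X, eval_C,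
    Complex.ofRealHom_eq_coe]
  have : (1 + Matrix.replicateRow Unit (star w) * Matrix.diagonal (fun i => (t - (d i : ℂ))⁻¹) *
      Matrix.replicateCol Unit (-w) : Matrix Unit Unit ℂ) default default =
      1 - ∑ i, (Complex.normSq (w i) : ℂ) * (t - d i)⁻¹ := by
    rw [Matrix.add_apply, Matrix.one_apply_eq, Matrix.mul_apply, sub_eq_add_neg,
      ← Finset.sum_neg_distrib]
    congr 1
    refine Finset.sum_congr rfl fun i _ => ?_
    rw [Matrix.mul_diagonal, Complex.normSq_eq_conj_mul_self]
    simp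
    ring
  rw [this, mul_sub, mul_one, Finset.mul_sum]
  congr 1
  refine Finset.sum_congr rfl fun i _ => ?_
  rw [← Finset.mul_prod_erase _ _ (Finset.mem_univ i)]
  field_simp [hne i]

/-- The squared moduli of the last `ν` coordinates are added; the others are kept. -/
noncomputable def groupedWeights {n ν : ℕ} (w : Fin (n + ν) → ℂ) : Fin (n + 1) → ℝ :=
  Fin.cons (∑ i : Fin ν, Complex.normSq (w (Fin.natAdd n i)))
    (fun j => Complex.normSq (w (Fin.castAdd ν j)))

/-- The ν terms with node 0 carry the same product, so their weights add up, and T^(ν-1) factors out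
of every term. The products with one index erased are identified by cancelling the missing linear
factor. -/
theorem charpoly_diagonal_append_add_vecMulVec {n ν : ℕ} (hν : 1 ≤ ν) (x : Fin n → ℝ)
    (w : Fin (n + ν) → ℂ) :
    (Matrix.diagonal (fun i => ((Fin.append x (fun _ : Fin ν => (0 : ℝ)) i : ℝ) : ℂ)) +
      Matrix.vecMulVec w (star w)).charpoly =
      (X ^ (ν - 1) * secularPoly (Fin.cons 0 x : Fin (n + 1) → ℝ) (groupedWeights w)).map
        Complex.ofRealHom := by
  rw [charpoly_diagonal_add_vecMulVec]
  congr 1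
  obtain ⟨k, rfl⟩ : ∃ k, ν = k + 1 := ⟨ν - 1, by omega⟩
  have hL : ∀ j : Fin n, ∏ i ∈ Finset.univ.erase (Fin.castAdd (k + 1) j),
      (X - C (Fin.append x (fun _ : Fin (k + 1) => (0 : ℝ)) i)) =
      X ^ (k + 1) * ∏ i ∈ Finset.univ.erase j, (X - C (x i)) := fun j => by
    have h1 := Finset.mul_prod_erase Finset.univ
      (fun i => X - C (Fin.append x (fun _ : Fin (k + 1) => (0 : ℝ)) i))
      (Finset.mem_univ (Fin.castAdd (k + 1) j))
    have h2 := Finset.mul_prod_erase Finset.univ (fun i => X - C (x i)) (Finset.mem_univ j)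
    simp only [Fin.prod_univ_add, Fin.append_left, Fin.append_right, map_zero, sub_zero,
      Finset.prod_const, Finset.card_univ, Fintype.card_fin] at h1
    rw [← h2, mul_assoc] at h1
    rw [mul_left_cancel₀ (X_sub_C_ne_zero (x j)) h1, mul_comm]
  have hR : ∀ j : Fin (k + 1), ∏ i ∈ Finset.univ.erase (Fin.natAdd n j),
      (X - C (Fin.append x (fun _ : Fin (k + 1) => (0 : ℝ)) i)) =
      X ^ k * ∏ i, (X - C (x i)) := fun j => by
    have h1 := Finset.mul_prod_erase Finset.univ
      (fun i => X - C (Fin.append x (fun _ : Fin (k + 1) => (0 : ℝ)) i))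
      (Finset.mem_univ (Fin.natAdd n j))
    simp only [Fin.prod_univ_add, Fin.append_left, Fin.append_right, map_zero, sub_zero,
      Finset.prod_const, Finset.card_univ, Fintype.card_fin] at h1
    refine mul_left_cancel₀ X_ne_zero (h1.trans ?_)
    ring
  have hz : ∀ j : Fin n, ∏ i ∈ Finset.univ.erase j.succ,
      (X - C ((Fin.cons 0 x : Fin (n + 1) → ℝ) i)) =
      X * ∏ i ∈ Finset.univ.erase j, (X - C (x i)) := fun j => by
    have h1 := Finset.mul_prod_erase Finset.univ
      (fun i => X - C ((Fin.cons 0 x : Fin (n + 1) → ℝ) i)) (Finset.mem_univ j.succ)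
    have h2 := Finset.mul_prod_erase Finset.univ (fun i => X - C (x i)) (Finset.mem_univ j)
    simp only [Fin.prod_univ_succ, Fin.cons_zero, Fin.cons_succ, map_zero, sub_zero] at h1
    refine mul_left_cancel₀ (X_sub_C_ne_zero (x j)) (h1.trans ?_)
    rw [← h2]; ring
  have h0 : ∏ i ∈ Finset.univ.erase (0 : Fin (n + 1)),
      (X - C ((Fin.cons 0 x : Fin (n + 1) → ℝ) i)) = ∏ i, (X - C (x i)) := by
    have h1 := Finset.mul_prod_erase Finset.univ
      (fun i => X - C ((Fin.cons 0 x : Fin (n + 1) → ℝ) i)) (Finset.mem_univ 0)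
    simp only [Fin.prod_univ_succ, Fin.cons_zero, Fin.cons_succ, map_zero, sub_zero] at h1
    exact mul_left_cancel₀ X_ne_zero h1
  have hS : secularPoly (Fin.cons 0 x : Fin (n + 1) → ℝ) (groupedWeights w) =
      X * ∏ i, (X - C (x i)) -
        (C (∑ i, Complex.normSq (w (Fin.natAdd n i))) * ∏ i, (X - C (x i)) +
        ∑ j, C (Complex.normSq (w (Fin.castAdd (k + 1) j))) *
          (X * ∏ i ∈ Finset.univ.erase j, (X - C (x i)))) := by
    rw [secularPoly, rootPoly, Fin.prod_univ_succ, Fin.sum_univ_succ]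
    simp only [hz, h0, Fin.cons_zero, Fin.cons_succ, map_zero, sub_zero, groupedWeights]
  rw [hS, Fin.prod_univ_add, Fin.sum_univ_add]
  simp only [hL, hR, Fin.append_left, Fin.append_right,
    map_zero, sub_zero, map_sum, Finset.prod_const, Finset.card_univ,
    Fintype.card_fin, Nat.add_sub_cancel]
  rw [← Finset.sum_mul, mul_sub, mul_add, Finset.mul_sum]
  rw [Finset.sum_congr rfl fun (i : Fin n) _ => show C (Complex.normSq (w (Fin.castAdd (k + 1) i))) *
      (X ^ (k + 1) * ∏ i ∈ Finset.univ.erase i, (X - C (x i))) =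
      X ^ k * (C (Complex.normSq (w (Fin.castAdd (k + 1) i))) *
        (X * ∏ i ∈ Finset.univ.erase i, (X - C (x i)))) by ring]
  ring

end Charpoly

-- Unitary diagonalization with eigenvalues in prescribed order.

section Diagonalization

/-- The fibres of x and y over each value have equal cardinality; gluing bijections between them
gives the permutation. -/
theorem exists_perm_of_map_eq {ι α : Type*} [Fintype ι] {x y : ι → α}
    (h : (Finset.univ : Finset ι).val.map x = (Finset.univ : Finset ι).val.map y) :
    ∃ σ : Equiv.Perm ι, x = y ∘ σ := by
  classical
  have hc : ∀ t, Nonempty ({i // x i = t} ≃ {i // y i = t}) := fun t => by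
    refine ⟨Fintype.equivOfCardEq ?_⟩
    have := congrArg (Multiset.count t) h
    rw [Multiset.count_map, Multiset.count_map] at this
    simp only [eq_comm (a := t)] at this
    rw [Fintype.card_subtype, Fintype.card_subtype]
    exact this
  refine ⟨Equiv.ofFiberEquiv fun t => (hc t).some, ?_⟩
  funext i
  exact (Equiv.ofFiberEquiv_map _ i).symm

theorem Matrix.IsHermitian.exists_unitary_diagonalization {N : ℕ} {A : Matrix (Fin N) (Fin N) ℂ}
    (hA : A.IsHermitian) {d : Fin N → ℝ}
    (hd : (Finset.univ : Finset (Fin N)).val.map hA.eigenvalues =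
      (Finset.univ : Finset (Fin N)).val.map d) :
    ∃ U ∈ Matrix.unitaryGroup (Fin N) ℂ,
      A = U * Matrix.diagonal (fun i => (d i : ℂ)) * star U := by
  obtain ⟨σ, hσ⟩ := exists_perm_of_map_eq hd
  set W : Matrix (Fin N) (Fin N) ℂ := (hA.eigenvectorUnitary : Matrix (Fin N) (Fin N) ℂ)
  have hW : W ∈ Matrix.unitaryGroup (Fin N) ℂ := hA.eigenvectorUnitary.2
  set V : Matrix (Fin N) (Fin N) ℂ := W.submatrix id σ.symm
  have hV : star V = (star W).submatrix σ.symm id := by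
    ext i j; rfl
  refine ⟨V, ?_, ?_⟩
  · rw [Matrix.mem_unitaryGroup_iff', hV, ← Matrix.submatrix_mul _ _ _ _ _ Function.bijective_id,
      Matrix.mem_unitaryGroup_iff'.1 hW, Matrix.submatrix_one_equiv]
  · have h := hA.spectral_theorem
    rw [Unitary.conjStarAlgAut_apply] at h
    have hD : Matrix.diagonal (fun i => (d i : ℂ)) =
        (Matrix.diagonal (RCLike.ofReal ∘ hA.eigenvalues : Fin N → ℂ)).submatrix σ.symm σ.symm := by
      rw [Matrix.submatrix_diagonal_equiv]
      congr 1; funext i; simp [hσ]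
    rw [hD, hV]
    rw [Matrix.submatrix_mul_equiv, Matrix.submatrix_mul_equiv, Matrix.submatrix_id_id]
    exact h

theorem posEigenvalues_eq_filter_eigenvalues {N : ℕ} {A : Matrix (Fin N) (Fin N) ℂ}
    (hA : A.IsHermitian) :
    posEigenvalues A =
      ((Finset.univ : Finset (Fin N)).val.map hA.eigenvalues).filter (fun t => 0 < t) := by
  rw [posEigenvalues, hA.roots_charpoly_eq_eigenvalues, Multiset.filter_map, Multiset.filter_map,
    Multiset.map_map]
  simp [Function.comp_def]

/-- The eigenvalues that are not positive are zero by semidefiniteness, and a count shows that there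
are ν of them. -/
theorem Matrix.PosSemidef.exists_unitary_diagonalization {n ν : ℕ}
    {A : Matrix (Fin (n + ν)) (Fin (n + ν)) ℂ} (hA : A.PosSemidef) {x : Fin n → ℝ}
    (hx : (Finset.univ : Finset (Fin n)).val.map x = posEigenvalues A) :
    ∃ U ∈ Matrix.unitaryGroup (Fin (n + ν)) ℂ,
      A = U * Matrix.diagonal
        (fun i => ((Fin.append x (fun _ : Fin ν => (0 : ℝ)) i : ℝ) : ℂ)) * star U := by
  apply hA.1.exists_unitary_diagonalization
  have h1 := Multiset.filter_add_not (fun t : ℝ => 0 < t)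
    ((Finset.univ : Finset (Fin (n + ν))).val.map hA.1.eigenvalues)
  rw [← posEigenvalues_eq_filter_eigenvalues hA.1, ← hx] at h1
  have h0 : (((Finset.univ : Finset (Fin (n + ν))).val.map hA.1.eigenvalues).filter
      fun t => ¬ 0 < t) = Multiset.replicate ν 0 := by
    rw [Multiset.eq_replicate]
    constructor
    · have := congrArg Multiset.card h1
      simpa using this
    · intro t ht
      rw [Multiset.mem_filter, Multiset.mem_map] at ht
      obtain ⟨⟨i, -, rfl⟩, hi⟩ := ht
      exact le_antisymm (not_lt.1 hi) (hA.eigenvalues_nonneg i)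
  rw [h0] at h1
  rw [← h1]
  rw [Fin.univ_val_map, Fin.univ_val_map, List.ofFn_fin_append, List.ofFn_const,
    ← Multiset.coe_add, Multiset.coe_replicate]

end Diagonalization

-- Densities of product measures.

section ProductDensity

theorem lintegral_fin_prod_eq_prod {n : ℕ} {α : Type*} [MeasurableSpace α]
    (μ : Fin n → Measure α) [∀ i, SigmaFinite (μ i)] {f : Fin n → α → ENNReal}
    (hf : ∀ i, Measurable (f i)) :
    ∫⁻ x, ∏ i, f i (x i) ∂Measure.pi μ = ∏ i, ∫⁻ t, f i t ∂μ i := by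
  induction n with
  | zero => simp
  | succ n ih =>
    rw [← (measurePreserving_piFinSuccAbove μ 0).symm.lintegral_comp_emb
      (MeasurableEquiv.measurableEmbedding _), Fin.prod_univ_succ,
      ← ih (fun i : Fin n => μ i.succ) (fun i => hf i.succ)]
    simp only [Fin.prod_univ_succ, MeasurableEquiv.piFinSuccAbove_symm_apply,
      Fin.insertNthEquiv_apply, Fin.insertNth_zero, Fin.cons_zero, Fin.cons_succ]
    exact lintegral_prod_mul (hf 0).aemeasurable
      (Finset.measurable_prod _ fun (i : Fin n) _ => (hf i.succ).comp (measurable_pi_apply i)).aemeasurable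

theorem pi_withDensity {n : ℕ} {α : Type*} [MeasurableSpace α]
    (μ : Fin n → Measure α) [∀ i, SigmaFinite (μ i)] {f : Fin n → α → ENNReal}
    (hf : ∀ i, Measurable (f i)) [∀ i, SigmaFinite ((μ i).withDensity (f i))] :
    Measure.pi (fun i => (μ i).withDensity (f i)) =
      (Measure.pi μ).withDensity (fun x => ∏ i, f i (x i)) := by
  refine Measure.pi_eq fun s hs => ?_
  rw [withDensity_apply _ (MeasurableSet.univ_pi hs), Measure.restrict_pi_pi,
    lintegral_fin_prod_eq_prod _ hf]
  exact Finset.prod_congr rfl fun i _ => (withDensity_apply _ (hs i)).symm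

end ProductDensity

-- Sums of independent exponential variables.

section Erlang

/-- The Gamma distribution with integer shape `k + 1` and rate `1`. -/
noncomputable def erlangMeasure (k : ℕ) : Measure ℝ :=
  (volume.restrict (Set.Ioi 0)).withDensity
    fun t => ENNReal.ofReal (t ^ k / k.factorial * Real.exp (-t))

instance (k : ℕ) : SigmaFinite (erlangMeasure k) := by
  unfold erlangMeasure
  exact SigmaFinite.withDensity_ofReal _

theorem measurable_erlangDensity (k : ℕ) :
    Measurable fun t : ℝ => ENNReal.ofReal (t ^ k / k.factorial * Real.exp (-t)) := by
  fun_prop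

theorem lintegral_erlangMeasure (k : ℕ) {f : ℝ → ENNReal} (hf : Measurable f) :
    ∫⁻ t, f t ∂erlangMeasure k =
      ∫⁻ t in Set.Ioi 0, ENNReal.ofReal (t ^ k / k.factorial * Real.exp (-t)) * f t := by
  rw [erlangMeasure, lintegral_withDensity_eq_lintegral_mul _ (measurable_erlangDensity k) hf]
  rfl

theorem lintegral_Ioo_pow (k : ℕ) {u : ℝ} (hu : 0 < u) :
    ∫⁻ b in Set.Ioo 0 u, ENNReal.ofReal (b ^ k / k.factorial) =
      ENNReal.ofReal (u ^ (k + 1) / (k + 1).factorial) := by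
  rw [← ofReal_integral_eq_lintegral_ofReal]
  · congr 1
    rw [← integral_Ioc_eq_integral_Ioo, ← intervalIntegral.integral_of_le hu.le,
      intervalIntegral.integral_div, integral_pow, Nat.factorial_succ]
    push_cast
    field_simp
    simp
  · exact ((by fun_prop : Continuous fun b : ℝ => b ^ k / k.factorial).integrableOn_Icc).mono_set
      Set.Ioo_subset_Icc_self
  · filter_upwards [ae_restrict_mem measurableSet_Ioo] with b hb
    have := hb.1
    positivity

/-- In the convolution, e^(-a) e^(-b) = e^(-(a+b)) depends only on the sum u, so what remains is the
integral of b^k/k! over (0, u). -/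
theorem map_add_erlangMeasure (k : ℕ) :
    ((erlangMeasure 0).prod (erlangMeasure k)).map (fun q : ℝ × ℝ => q.1 + q.2) =
      erlangMeasure (k + 1) := by
  refine Measure.ext_of_lintegral _ fun f hf => ?_
  rw [lintegral_map hf (by fun_prop), lintegral_prod_symm _ (by fun_prop),
    lintegral_erlangMeasure _ (by fun_prop), lintegral_erlangMeasure _ hf]
  -- Substitution u = a + b in the inner integral.
  have h1 : ∀ b : ℝ, 0 < b → ENNReal.ofReal (b ^ k / k.factorial * Real.exp (-b)) *
      ∫⁻ a, f (a + b) ∂erlangMeasure 0 =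
      ∫⁻ u in Set.Ioi 0, (Set.Ioi b).indicator (fun u => ENNReal.ofReal (b ^ k / k.factorial) *
        (ENNReal.ofReal (Real.exp (-u)) * f u)) u := fun b hb => by
    rw [lintegral_erlangMeasure _ (by fun_prop), ← lintegral_const_mul _ (by fun_prop),
      lintegral_indicator measurableSet_Ioi, Measure.restrict_restrict measurableSet_Ioi,
      Set.inter_eq_left.2 (Set.Ioi_subset_Ioi hb.le), ← lintegral_indicator measurableSet_Ioi,
      ← lintegral_indicator measurableSet_Ioi,
      ← lintegral_add_right_eq_self ((Set.Ioi b).indicator _) b]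
    refine lintegral_congr fun a => ?_
    by_cases ha : 0 < a
    · rw [Set.indicator_of_mem (Set.mem_Ioi.2 ha), Set.indicator_of_mem (Set.mem_Ioi.2 (by linarith)),
        ← mul_assoc, ← mul_assoc, ← ENNReal.ofReal_mul (by positivity),
        ← ENNReal.ofReal_mul (by positivity)]
      congr 2
      rw [neg_add, Real.exp_add]
      simp
      ring
    · rw [Set.indicator_of_notMem (by simpa using ha),
        Set.indicator_of_notMem (by simpa using ha)]
  rw [setLIntegral_congr_fun measurableSet_Ioi h1, lintegral_lintegral_swap]
  · refine setLIntegral_congr_fun measurableSet_Ioi fun u hu => ?_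
    have hu : 0 < u := hu
    have h2 : ∀ b, (Set.Ioi b).indicator (fun u => ENNReal.ofReal (b ^ k / k.factorial) *
        (ENNReal.ofReal (Real.exp (-u)) * f u)) u = (Set.Iio u).indicator (fun b =>
        ENNReal.ofReal (b ^ k / k.factorial) * (ENNReal.ofReal (Real.exp (-u)) * f u)) b :=
      fun b => by simp [Set.indicator]
    simp only [h2]
    rw [lintegral_indicator measurableSet_Iio, Measure.restrict_restrict measurableSet_Iio,
      Set.inter_comm, Set.Ioi_inter_Iio, lintegral_mul_const _ (by fun_prop),
      lintegral_Ioo_pow k hu, ← mul_assoc, ← ENNReal.ofReal_mul (by positivity)]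
  · have : (Function.uncurry fun (b u : ℝ) => (Set.Ioi b).indicator (fun u =>
        ENNReal.ofReal (b ^ k / k.factorial) * (ENNReal.ofReal (Real.exp (-u)) * f u)) u) =
        {q : ℝ × ℝ | q.1 < q.2}.indicator (fun q => ENNReal.ofReal (q.1 ^ k / k.factorial) *
          (ENNReal.ofReal (Real.exp (-q.2)) * f q.2)) := by
      funext q
      simp [Function.uncurry, Set.indicator]
    rw [this]
    exact (Measurable.indicator (by fun_prop) (measurableSet_lt measurable_fst measurable_snd)).aemeasurable

theorem map_sum_pi_erlangMeasure (k : ℕ) :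
    (Measure.pi fun _ : Fin (k + 1) => erlangMeasure 0).map (fun q => ∑ i, q i) =
      erlangMeasure k := by
  induction k with
  | zero =>
    have h := (measurePreserving_funUnique (erlangMeasure 0) (Fin 1)).map_eq
    convert h using 2
    · funext q
      exact Fin.sum_univ_one q
    · congr!
  | succ k ih =>
    have h := (measurePreserving_piFinSuccAbove (fun _ : Fin (k + 2) => erlangMeasure 0) 0).map_eq
    have he : (fun q : Fin (k + 2) → ℝ => ∑ i, q i) = (fun r : ℝ × ℝ => r.1 + r.2) ∘
        (Prod.map id fun q : Fin (k + 1) → ℝ => ∑ i, q i) ∘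
        MeasurableEquiv.piFinSuccAbove (fun _ => ℝ) (0 : Fin (k + 2)) := by
      funext q
      exact Fin.sum_univ_succ q
    have hms : Measurable fun q : Fin (k + 1) → ℝ => ∑ i, q i := by fun_prop
    rw [he, ← Measure.map_map (by fun_prop) ((measurable_id.prodMap hms).comp (MeasurableEquiv.measurable _)),
      ← Measure.map_map (measurable_id.prodMap hms) (MeasurableEquiv.measurable _), h,
      ← Measure.map_prod_map _ _ measurable_id hms, ih, Measure.map_id, map_add_erlangMeasure]

end Erlang

-- Unitary invariance of the Gaussian vector and the law of the weights.

section ComplexGaussian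

/-- The standard Gaussian distribution on `ℂ`. -/
noncomputable def complexGaussian : Measure ℂ :=
  ((gaussianReal 0 (1 / 2)).prod (gaussianReal 0 (1 / 2))).map Complex.measurableEquivRealProd.symm

instance : IsProbabilityMeasure complexGaussian :=
  Measure.isProbabilityMeasure_map (MeasurableEquiv.measurable _).aemeasurable

theorem charFun_complexGaussian (t : ℂ) :
    charFun complexGaussian t = Complex.exp (-‖t‖ ^ 2 / 4) := by
  have h : ∀ s : ℝ, charFun (gaussianReal 0 (1 / 2)) s = Complex.exp (-s ^ 2 / 4) := fun s => by
    rw [charFun_gaussianReal]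
    congr 1
    simp
    ring
  rw [charFun_apply, complexGaussian, integral_map (MeasurableEquiv.measurable _).aemeasurable
    (by fun_prop)]
  have h2 : ∀ q : ℝ × ℝ, Complex.exp (inner ℝ (Complex.measurableEquivRealProd.symm q) t *
      Complex.I) = Complex.exp (t.re * q.1 * Complex.I) * Complex.exp (t.im * q.2 * Complex.I) := by
    intro q
    rw [← Complex.exp_add, Complex.inner]
    congr 1
    simp [Complex.measurableEquivRealProd]
    ring
  simp only [h2]
  rw [integral_prod_mul (fun a : ℝ => Complex.exp (t.re * a * Complex.I))
    (fun b : ℝ => Complex.exp (t.im * b * Complex.I)), ← charFun_apply_real, ← charFun_apply_real,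
    h, h, ← Complex.exp_add]
  congr 1
  rw [← Complex.ofReal_pow ‖t‖, Complex.sq_norm, Complex.normSq_apply]
  push_cast
  ring

/-- Polar coordinates, then t = r²: the angle integrates to 2π, and the density e^(-r²)/π becomes
e^(-t). -/
theorem map_normSq_complexGaussian : complexGaussian.map Complex.normSq = erlangMeasure 0 := by
  refine Measure.ext_of_lintegral _ fun f hf => ?_
  have hn : Measurable Complex.normSq := Complex.continuous_normSq.measurable
  have hN : gaussianReal 0 (1 / 2) = volume.withDensity (gaussianPDF 0 (1 / 2)) :=
    gaussianReal_of_var_ne_zero _ (by norm_num)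
  have hm : Measurable (gaussianPDF 0 (1 / 2)) := measurable_gaussianPDF _ _
  have hfe : Measurable fun q : ℝ × ℝ =>
      f (Complex.normSq (Complex.measurableEquivRealProd.symm q)) :=
    (hf.comp hn).comp (MeasurableEquiv.measurable _)
  rw [lintegral_map hf hn, complexGaussian, lintegral_map_equiv,
    hN, prod_withDensity hm hm, lintegral_withDensity_eq_lintegral_mul _ (by fun_prop) hfe,
    ← Measure.volume_eq_prod,
    ← lintegral_comp_polarCoord_symm, lintegral_erlangMeasure 0 hf]
  have h1 : ∀ q ∈ polarCoord.target, ENNReal.ofReal q.1 •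
      ((fun z : ℝ × ℝ => gaussianPDF 0 (1 / 2) z.1 * gaussianPDF 0 (1 / 2) z.2) *
        (fun q : ℝ × ℝ => f (Complex.normSq (Complex.measurableEquivRealProd.symm q))))
          (polarCoord.symm q) =
      ENNReal.ofReal (q.1 * Real.exp (-q.1 ^ 2)) * f (q.1 ^ 2) * ENNReal.ofReal (Real.pi⁻¹) := by
    intro q hq
    have hq1 : 0 < q.1 := hq.1
    have hns : Complex.normSq (Complex.measurableEquivRealProd.symm (polarCoord.symm q)) = q.1 ^ 2 := by
      simp [Complex.measurableEquivRealProd, Complex.normSq_apply, polarCoord_symm_apply]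
      nlinarith [Real.cos_sq_add_sin_sq q.2]
    simp only [Pi.mul_apply, hns, gaussianPDF, gaussianPDFReal, smul_eq_mul]
    rw [← ENNReal.ofReal_mul (by positivity), ← mul_assoc, ← ENNReal.ofReal_mul hq1.le,
      mul_right_comm (ENNReal.ofReal _) (f _), ← ENNReal.ofReal_mul (by positivity)]
    congr 2
    have h2 : (√(2 * Real.pi * ((1 / 2 : NNReal) : ℝ)))⁻¹ * (√(2 * Real.pi * ((1 / 2 : NNReal) : ℝ)))⁻¹ =
        Real.pi⁻¹ := by
      rw [← mul_inv, Real.mul_self_sqrt (by positivity)]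
      simp
      ring
    have h3 : Real.exp (-((polarCoord.symm q).1 - 0) ^ 2 / (2 * ((1 / 2 : NNReal) : ℝ))) *
        Real.exp (-((polarCoord.symm q).2 - 0) ^ 2 / (2 * ((1 / 2 : NNReal) : ℝ))) =
        Real.exp (-q.1 ^ 2) := by
      rw [← Real.exp_add]
      congr 1
      simp [polarCoord_symm_apply]
      nlinarith [Real.cos_sq_add_sin_sq q.2]
    rw [← h2, ← h3]
    ring
  rw [setLIntegral_congr_fun polarCoord.open_target.measurableSet h1, polarCoord_target,
    Measure.volume_eq_prod, ← Measure.prod_restrict,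
    lintegral_prod_mul (f := fun r : ℝ => ENNReal.ofReal (r * Real.exp (-r ^ 2)) * f (r ^ 2))
      (g := fun _ => ENNReal.ofReal Real.pi⁻¹) (by fun_prop) (by fun_prop)]
  have himg : (fun r : ℝ => r ^ 2) '' Set.Ioi 0 = Set.Ioi 0 := by
    ext u
    constructor
    · rintro ⟨r, hr, rfl⟩
      exact pow_pos (Set.mem_Ioi.1 hr) 2
    · intro hu
      exact ⟨√u, Real.sqrt_pos.2 hu, Real.sq_sqrt (Set.mem_Ioi.1 hu).le⟩
  have hcv := lintegral_image_eq_lintegral_abs_deriv_mul (s := Set.Ioi (0 : ℝ))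
    (f := fun r => r ^ 2) (f' := fun r => 2 * r) measurableSet_Ioi
    (fun r _ => by simpa using (hasDerivAt_pow 2 r).hasDerivWithinAt)
    (fun r hr s hs h => by
      exact (pow_left_inj₀ (Set.mem_Ioi.1 hr).le (Set.mem_Ioi.1 hs).le two_ne_zero).1 h)
    (fun t => ENNReal.ofReal (t ^ 0 / Nat.factorial 0 * Real.exp (-t)) * f t)
  rw [himg] at hcv
  rw [hcv, lintegral_const, Measure.restrict_apply MeasurableSet.univ, Set.univ_inter,
    Real.volume_Ioo, ← ENNReal.ofReal_mul (by positivity),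
    ← lintegral_mul_const _ (by fun_prop)]
  refine setLIntegral_congr_fun measurableSet_Ioi fun r hr => ?_
  have hr : 0 < r := hr
  -- Angular mass times 1/π is the factor 2 in dt = 2r dr.
  have h4 : Real.pi⁻¹ * (Real.pi - -Real.pi) = 2 := by
    field_simp
    norm_num
  rw [h4, mul_right_comm, ← ENNReal.ofReal_mul (by positivity), ← mul_assoc,
    ← ENNReal.ofReal_mul (by positivity), abs_of_pos (by positivity)]
  simp
  ring_nf

/-- The 2m real coordinates have a product law; regrouping them in pairs (Re, Im) is measure
preserving. -/
theorem IsStdComplexGaussianVector.map_eq {Ω : Type*} [MeasurableSpace Ω] {μ : Measure Ω}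
    [IsProbabilityMeasure μ] {m : ℕ} {v : Ω → Fin m → ℂ} (hv : IsStdComplexGaussianVector μ v) :
    μ.map v = Measure.pi fun _ => complexGaussian := by
  obtain ⟨hre, him, hind⟩ := hv
  have hmeas : ∀ p : Fin m ⊕ Fin m, AEMeasurable (fun ω =>
      Sum.elim (fun j => (v ω j).re) (fun j => (v ω j).im) p) μ := by
    rintro (j | j)
    · exact (hre j).aemeasurable
    · exact (him j).aemeasurable
  have h1 := (iIndepFun_iff_map_fun_eq_pi_map hmeas).1 hind
  have h2 : (fun p : Fin m ⊕ Fin m => μ.map (fun ω =>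
      Sum.elim (fun j => (v ω j).re) (fun j => (v ω j).im) p)) =
      fun _ => gaussianReal 0 (1 / 2) := by
    funext p
    rcases p with j | j
    · exact (hre j).map_eq
    · exact (him j).map_eq
  rw [h2] at h1
  have hA := (measurePreserving_arrowProdEquivProdArrow ℝ ℝ (Fin m)
    (fun _ => gaussianReal 0 (1 / 2)) (fun _ => gaussianReal 0 (1 / 2))).symm
  have hS := measurePreserving_sumPiEquivProdPi (X := fun _ : Fin m ⊕ Fin m => ℝ)
    (fun _ => gaussianReal 0 (1 / 2))
  have hC : (Measure.pi fun _ : Fin m => complexGaussian) =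
      (Measure.pi fun _ : Fin m => (gaussianReal 0 (1 / 2)).prod (gaussianReal 0 (1 / 2))).map
        (fun x j => Complex.measurableEquivRealProd.symm (x j)) := by
    have : ∀ _ : Fin m, SigmaFinite (((gaussianReal 0 (1 / 2)).prod (gaussianReal 0 (1 / 2))).map
      Complex.measurableEquivRealProd.symm) := fun _ => by
        change SigmaFinite complexGaussian; infer_instance
    rw [Measure.pi_map_pi (fun _ => (MeasurableEquiv.measurable _).aemeasurable)]
    rfl
  have hmC : Measurable fun (x : Fin m → ℝ × ℝ) j => Complex.measurableEquivRealProd.symm (x j) := by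
    exact measurable_pi_lambda _ fun j =>
      (MeasurableEquiv.measurable _).comp (measurable_pi_apply j)
  rw [hC, ← hA.map_eq, Measure.map_map hmC hA.measurable, ← hS.map_eq,
    Measure.map_map (hmC.comp hA.measurable) hS.measurable, ← h1,
    AEMeasurable.map_map_of_aemeasurable ((hmC.comp hA.measurable).comp hS.measurable).aemeasurable
      (aemeasurable_pi_lambda _ hmeas)]
  rfl

/-- The characteristic function depends only on the Euclidean norm, and a unitary matrix is a
surjective real-linear isometry of ℂᵐ. -/
theorem map_unitary_pi_complexGaussian {m : ℕ} {U : Matrix (Fin m) (Fin m) ℂ}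
    (hU : U ∈ Matrix.unitaryGroup (Fin m) ℂ) :
    (Measure.pi fun _ : Fin m => complexGaussian).map U.mulVec =
      Measure.pi fun _ : Fin m => complexGaussian := by
  have hnorm : ∀ x : PiLp 2 (fun _ : Fin m => ℂ),
      ‖WithLp.toLp 2 (U.mulVec (WithLp.ofLp x))‖ = ‖x‖ := fun x => by
    have h : ∀ z : PiLp 2 (fun _ : Fin m => ℂ),
        ((‖z‖ ^ 2 : ℝ) : ℂ) = star (WithLp.ofLp z) ⬝ᵥ WithLp.ofLp z := fun z => by
      rw [PiLp.norm_sq_eq_of_L2, dotProduct]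
      push_cast
      refine Finset.sum_congr rfl fun i _ => ?_
      simp [← Complex.normSq_eq_conj_mul_self, Complex.normSq_eq_norm_sq]
    have h2 : ((‖WithLp.toLp 2 (U.mulVec (WithLp.ofLp x))‖ ^ 2 : ℝ) : ℂ) = ((‖x‖ ^ 2 : ℝ) : ℂ) := by
      rw [h, h, Matrix.star_mulVec, Matrix.dotProduct_mulVec, Matrix.vecMul_vecMul,
        ← Matrix.star_eq_conjTranspose, Matrix.mem_unitaryGroup_iff'.1 hU, Matrix.vecMul_one]
    exact (pow_left_inj₀ (norm_nonneg _) (norm_nonneg _) two_ne_zero).1 (Complex.ofReal_injective h2)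
  let L : PiLp 2 (fun _ : Fin m => ℂ) →ₗᵢ[ℝ] PiLp 2 (fun _ : Fin m => ℂ) :=
    { toFun := fun x => WithLp.toLp 2 (U.mulVec (WithLp.ofLp x))
      map_add' := fun x y => by simp [Matrix.mulVec_add]
      map_smul' := fun r x => by simp [Matrix.mulVec_smul]
      norm_map' := hnorm }
  set γ := (Measure.pi fun _ : Fin m => complexGaussian)
  have hch : ∀ t : PiLp 2 (fun _ : Fin m => ℂ),
      charFun (γ.map (WithLp.toLp 2)) t = Complex.exp (-‖t‖ ^ 2 / 4) := fun t => by
    rw [charFun_pi, Finset.prod_congr rfl fun i _ => charFun_complexGaussian (t i),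
      ← Complex.exp_sum]
    congr 1
    rw [← Complex.ofReal_pow, PiLp.norm_sq_eq_of_L2]
    push_cast
    rw [← Finset.sum_div, ← Finset.sum_neg_distrib]
  have hinv : (γ.map (WithLp.toLp 2)).map L = γ.map (WithLp.toLp 2) := by
    refine Measure.ext_of_charFun ?_
    funext t
    obtain ⟨s, rfl⟩ : ∃ s, L s = t := ⟨WithLp.toLp 2 ((star U).mulVec (WithLp.ofLp t)), by
      change WithLp.toLp 2 (U.mulVec ((star U).mulVec (WithLp.ofLp t))) = t
      rw [Matrix.mulVec_mulVec, Matrix.mem_unitaryGroup_iff.1 hU, Matrix.one_mulVec]⟩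
    rw [hch, L.norm_map, ← hch s, charFun_apply, charFun_apply,
      integral_map L.continuous.aemeasurable (by fun_prop)]
    simp only [L.inner_map_map]
  have hto : Measurable (WithLp.toLp 2 : (Fin m → ℂ) → PiLp 2 (fun _ : Fin m => ℂ)) := by fun_prop
  have hof : Measurable (WithLp.ofLp : PiLp 2 (fun _ : Fin m => ℂ) → (Fin m → ℂ)) := by fun_prop
  have h3 := congrArg (Measure.map WithLp.ofLp) hinv
  rw [Measure.map_map L.continuous.measurable hto,
    Measure.map_map hof (L.continuous.measurable.comp hto), Measure.map_map hof hto] at h3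
  have hid : WithLp.ofLp ∘ (WithLp.toLp 2 : (Fin m → ℂ) → PiLp 2 (fun _ : Fin m => ℂ)) = id := rfl
  rw [hid, Measure.map_id] at h3
  exact h3

/-- The squared moduli are independent exponentials; the last ν of them are summed to a Gamma(ν)
variable and moved to position 0. -/
theorem map_groupedWeights_pi_complexGaussian {n ν : ℕ} (hν : 1 ≤ ν) :
    (Measure.pi fun _ : Fin (n + ν) => complexGaussian).map groupedWeights =
      (volume.restrict {p : Fin (n + 1) → ℝ | ∀ j, 0 < p j}).withDensity fun p =>
        ENNReal.ofReal (p 0 ^ (ν - 1) / (ν - 1).factorial * Real.exp (-∑ j, p j)) := by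
  obtain ⟨k, rfl⟩ : ∃ k, ν = k + 1 := ⟨ν - 1, by omega⟩
  have hn : Measurable Complex.normSq := Complex.continuous_normSq.measurable
  have h1 : (Measure.pi fun _ : Fin (n + (k + 1)) => complexGaussian).map
      (fun w i => Complex.normSq (w i)) = Measure.pi fun _ => erlangMeasure 0 := by
    have : ∀ _ : Fin (n + (k + 1)), SigmaFinite (complexGaussian.map Complex.normSq) := fun _ => by
      rw [map_normSq_complexGaussian]; infer_instance
    rw [Measure.pi_map_pi (fun _ => hn.aemeasurable)]
    simp only [map_normSq_complexGaussian]
  have h2 := (measurePreserving_piCongrLeft (α := fun _ => ℝ)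
    (fun _ : Fin (n + (k + 1)) => erlangMeasure 0) finSumFinEquiv).symm
  have h3 := measurePreserving_sumPiEquivProdPi (X := fun _ : Fin n ⊕ Fin (k + 1) => ℝ)
    (fun _ => erlangMeasure 0)
  have hms : Measurable fun q : Fin (k + 1) → ℝ => ∑ i, q i := by fun_prop
  have h4 : (((Measure.pi fun _ : Fin n => erlangMeasure 0).prod
      (Measure.pi fun _ : Fin (k + 1) => erlangMeasure 0)).map
        (Prod.map id fun q : Fin (k + 1) → ℝ => ∑ i, q i)) =
      (Measure.pi fun _ : Fin n => erlangMeasure 0).prod (erlangMeasure k) := by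
    rw [← Measure.map_prod_map _ _ measurable_id hms, map_sum_pi_erlangMeasure, Measure.map_id]
  have h5 := (measurePreserving_piFinSuccAbove
    (fun i : Fin (n + 1) => erlangMeasure ((Fin.cons k fun _ => 0 : Fin (n + 1) → ℕ) i)) 0).symm
  have h6 : (Measure.pi fun i : Fin (n + 1) =>
      erlangMeasure ((Fin.cons k fun _ => 0 : Fin (n + 1) → ℕ) i)) =
      (volume.restrict {p : Fin (n + 1) → ℝ | ∀ j, 0 < p j}).withDensity fun p =>
        ENNReal.ofReal (p 0 ^ k / k.factorial * Real.exp (-∑ j, p j)) := by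
    have hσ : ∀ i : Fin (n + 1), SigmaFinite ((volume.restrict (Set.Ioi (0 : ℝ))).withDensity
        fun t => ENNReal.ofReal (t ^ ((Fin.cons k fun _ => 0 : Fin (n + 1) → ℕ) i) /
          ((Fin.cons k fun _ => 0 : Fin (n + 1) → ℕ) i).factorial * Real.exp (-t))) :=
      fun i => SigmaFinite.withDensity_ofReal _
    have h := pi_withDensity (fun _ : Fin (n + 1) => volume.restrict (Set.Ioi (0 : ℝ)))
      (f := fun i t => ENNReal.ofReal (t ^ ((Fin.cons k fun _ => 0 : Fin (n + 1) → ℕ) i) /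
          ((Fin.cons k fun _ => 0 : Fin (n + 1) → ℕ) i).factorial * Real.exp (-t)))
      (fun i => measurable_erlangDensity _)
    refine h.trans ?_
    have hset : {p : Fin (n + 1) → ℝ | ∀ j, 0 < p j} = Set.univ.pi fun _ => Set.Ioi 0 := by
      ext p; simp
    rw [hset, volume_pi, Measure.restrict_pi_pi]
    refine withDensity_congr_ae ?_
    rw [← Measure.restrict_pi_pi]
    filter_upwards [ae_restrict_mem (MeasurableSet.univ_pi fun _ => measurableSet_Ioi)] with p hp
    have hp : ∀ j, 0 < p j := fun j => hp j (Set.mem_univ j)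
    rw [← ENNReal.ofReal_prod_of_nonneg fun i _ => by have := hp i; positivity]
    congr 1
    rw [Finset.prod_mul_distrib, ← Real.exp_sum, Finset.sum_neg_distrib, Fin.prod_univ_succ]
    simp
  have h5' : MeasurePreserving (MeasurableEquiv.piFinSuccAbove (fun _ => ℝ) (0 : Fin (n + 1))).symm
      ((erlangMeasure k).prod (Measure.pi fun _ : Fin n => erlangMeasure 0))
      (Measure.pi fun i : Fin (n + 1) =>
        erlangMeasure ((Fin.cons k fun _ => 0 : Fin (n + 1) → ℕ) i)) := by
    simpa using h5
  have hn' : Measurable fun (w : Fin (n + (k + 1)) → ℂ) i => Complex.normSq (w i) :=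
    measurable_pi_lambda _ fun i => hn.comp (measurable_pi_apply i)
  have hcomp := h5'.comp ((Measure.measurePreserving_swap).comp
    ((⟨measurable_id.prodMap hms, h4⟩ : MeasurePreserving _ _ _).comp (h3.comp (h2.comp
      (⟨hn', h1⟩ : MeasurePreserving _ _ _)))))
  rw [Nat.add_sub_cancel, ← h6, ← hcomp.map_eq]
  congr 1
  funext w
  refine funext (Fin.cases ?_ fun j => ?_)
  · rfl
  · rfl

end ComplexGaussian

-- Spectral events and their measurability.

section SpectralPoly

open Polynomial

/-- The increasingly ordered tuples of positive reals. -/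
def orderedPositive (m : ℕ) : Set (Fin m → ℝ) := {y | StrictMono y ∧ ∀ i, 0 < y i}

/-- The complex polynomial with positive roots `y` and the root zero of multiplicity `ν - 1`. -/
noncomputable def spectralPoly (ν : ℕ) {m : ℕ} (y : Fin m → ℝ) : ℂ[X] :=
  (X ^ (ν - 1) * rootPoly y).map Complex.ofRealHom

variable {m : ℕ}

theorem spectralPoly_injOn (ν : ℕ) : Set.InjOn (spectralPoly ν (m := m)) {y | StrictMono y} := by
  intro x hx y hy h
  exact rootPoly_injOn hx hy (mul_left_cancel₀ (pow_ne_zero _ X_ne_zero)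
    (map_injective _ Complex.ofRealHom.injective h))

theorem eval_spectralPoly (ν : ℕ) (y : Fin m → ℝ) (t : ℂ) :
    (spectralPoly ν y).eval t = t ^ (ν - 1) * ∏ i, (t - y i) := by
  simp [spectralPoly, rootPoly, Polynomial.map_prod, eval_prod]

theorem roots_spectralPoly (ν : ℕ) (y : Fin m → ℝ) :
    (spectralPoly ν y).roots = Multiset.replicate (ν - 1) 0 +
      (Finset.univ : Finset (Fin m)).val.map (fun i => (y i : ℂ)) := by
  have h : (∏ i, (X - C (y i : ℂ))) ≠ 0 := Finset.prod_ne_zero_iff.2 fun i _ => X_sub_C_ne_zero _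
  have : spectralPoly ν y = X ^ (ν - 1) * ∏ i, (X - C (y i : ℂ)) := by
    simp [spectralPoly, rootPoly, Polynomial.map_prod]
  rw [this, roots_mul (mul_ne_zero (pow_ne_zero _ X_ne_zero) h), roots_X_pow,
    Polynomial.roots_prod _ _ h, Multiset.nsmul_singleton]
  simp

theorem posEigenvalues_of_charpoly_eq {N ν : ℕ} {M : Matrix (Fin N) (Fin N) ℂ} {y : Fin m → ℝ}
    (hy : ∀ i, 0 < y i) (h : M.charpoly = spectralPoly ν y) :
    posEigenvalues M = (Finset.univ : Finset (Fin m)).val.map y := by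
  rw [posEigenvalues, h, roots_spectralPoly, Multiset.filter_add, Multiset.map_add,
    Multiset.filter_eq_nil.2, Multiset.filter_eq_self.2, Multiset.map_map]
  · simp
  · intro z hz
    obtain ⟨i, -, rfl⟩ := Multiset.mem_map.1 hz
    simpa using hy i
  · intro z hz
    rw [Multiset.eq_of_mem_replicate hz]
    simp

theorem rootMultiplicity_zero_of_charpoly_eq {N ν : ℕ} {M : Matrix (Fin N) (Fin N) ℂ}
    {y : Fin m → ℝ} (hy : ∀ i, 0 < y i) (h : M.charpoly = spectralPoly ν y) :
    M.charpoly.rootMultiplicity 0 = ν - 1 := by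
  rw [← count_roots, h, roots_spectralPoly, Multiset.count_add, Multiset.count_replicate_self,
    Multiset.count_eq_zero.2, add_zero]
  intro hz
  obtain ⟨i, -, hi⟩ := Multiset.mem_map.1 hz
  exact (hy i).ne' (by simpa using hi)

/-- The set of matrices whose characteristic polynomial has the positive roots `y` for some
increasingly ordered `y ∈ B`, and the root zero of multiplicity `ν - 1`. -/
def HasSpectrumIn (ν : ℕ) {N : ℕ} (B : Set (Fin m → ℝ)) (M : Matrix (Fin N) (Fin N) ℂ) : Prop :=
  ∃ y ∈ B ∩ orderedPositive m, M.charpoly = spectralPoly ν y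

theorem measurableSet_orderedPositive (m : ℕ) : MeasurableSet (orderedPositive m) := by
  have : orderedPositive m = (⋂ i, ⋂ j, ⋂ _ : i < j, {y : Fin m → ℝ | y i < y j}) ∩
      ⋂ i, {y | 0 < y i} := by
    ext y
    simp [orderedPositive, StrictMono]
  rw [this]
  refine MeasurableSet.inter (MeasurableSet.iInter fun i => MeasurableSet.iInter fun j =>
    MeasurableSet.iInter fun _ => measurableSet_lt (by fun_prop) (by fun_prop))
    (MeasurableSet.iInter fun i => measurableSet_lt (by fun_prop) (by fun_prop))

/-- No measurable choice of eigenvalues is made. A polynomial is encoded by its values at the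
natural numbers; the encodings of ordered root tuples in B form a continuous injective image of a
Borel set, hence are Borel by Lusin–Souslin. -/
theorem measurableSet_hasSpectrumIn {α : Type*} [MeasurableSpace α] {N : ℕ} (ν : ℕ)
    {B : Set (Fin m → ℝ)} (hB : MeasurableSet B) {M : α → Matrix (Fin N) (Fin N) ℂ}
    (hM : ∀ i j, Measurable fun a => M a i j) : MeasurableSet {a | HasSpectrumIn ν B (M a)} := by
  have hev : ∀ p q : ℂ[X], (fun k : ℕ => p.eval (k : ℂ)) = (fun k : ℕ => q.eval (k : ℂ)) → p = q := by
    intro p q h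
    refine eq_of_infinite_eval_eq p q (Set.Infinite.mono ?_
      (Set.infinite_range_of_injective (Nat.cast_injective (R := ℂ))))
    rintro _ ⟨k, rfl⟩
    exact congrFun h k
  have hset : {a | HasSpectrumIn ν B (M a)} = (fun a (k : ℕ) => (M a).charpoly.eval (k : ℂ)) ⁻¹'
      ((fun (y : Fin m → ℝ) (k : ℕ) => (spectralPoly ν y).eval (k : ℂ)) ''
        (B ∩ orderedPositive m)) := by
    ext a
    constructor
    · rintro ⟨y, hy, h⟩
      exact ⟨y, hy, by simp only [h]⟩
    · rintro ⟨y, hy, h⟩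
      exact ⟨y, hy, (hev _ _ h).symm⟩
  rw [hset]
  refine MeasurableSet.preimage ((hB.inter (measurableSet_orderedPositive m)).image_of_continuousOn_injOn
    ?_ ?_) ?_
  · simp only [eval_spectralPoly]
    fun_prop
  · intro x hx y hy h
    exact spectralPoly_injOn ν hx.2.1 hy.2.1 (hev _ _ h)
  · refine measurable_pi_lambda _ fun k => ?_
    simp only [Matrix.eval_charpoly, Matrix.det_apply]
    refine Finset.measurable_sum _ fun σ _ => Measurable.const_smul
      (Finset.measurable_prod _ fun i _ => ?_) _
    simp only [Matrix.sub_apply]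
    exact measurable_const.sub (hM _ _)

end SpectralPoly

-- Law of the new eigenvalues for a fixed matrix.

section ConditionalLaw

/-- The conditional density of the positive eigenvalues `y` of the rank one modification, given the
positive eigenvalues `x`; the zero eigenvalue of the unperturbed matrix has multiplicity `ν`. -/
noncomputable def rankOneKernel (ν : ℕ) {n : ℕ} (x : Fin n → ℝ) (y : Fin (n + 1) → ℝ) : ℝ :=
  vandermondeProd y / vandermondeProd (Fin.cons 0 x : Fin (n + 1) → ℝ) *
    (((∏ i, y i) / ∏ j, x j) ^ (ν - 1) / (ν - 1).factorial * Real.exp (-(∑ i, y i - ∑ j, x j)))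

theorem strictMono_cons_zero {n : ℕ} {x : Fin n → ℝ} (hx : x ∈ orderedPositive n) :
    StrictMono (Fin.cons 0 x : Fin (n + 1) → ℝ) := by
  intro i j hij
  induction j using Fin.cases with
  | zero => exact absurd hij (Fin.not_lt_zero i)
  | succ j =>
    induction i using Fin.cases with
    | zero => simpa using hx.2 j
    | succ i => simpa using hx.1 (Fin.succ_lt_succ_iff.1 hij)

theorem Interlaces.mem_orderedPositive {n : ℕ} {x : Fin n → ℝ} {y : Fin (n + 1) → ℝ}
    (hx : x ∈ orderedPositive n) (h : Interlaces (Fin.cons 0 x : Fin (n + 1) → ℝ) y) :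
    y ∈ orderedPositive (n + 1) :=
  ⟨h.strictMono_right, fun i => lt_of_le_of_lt (by
    simpa using (strictMono_cons_zero hx).monotone (Fin.zero_le i)) (h.1 i)⟩

theorem measurableSet_interlaces (m : ℕ) :
    MeasurableSet {q : (Fin m → ℝ) × (Fin m → ℝ) | Interlaces q.1 q.2} := by
  have : {q : (Fin m → ℝ) × (Fin m → ℝ) | Interlaces q.1 q.2} = (⋂ i, {q | q.1 i < q.2 i}) ∩
      ⋂ i, ⋂ j, ⋂ _ : i < j, {q | q.2 i < q.1 j} := by
    ext q
    simp [Interlaces]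
  rw [this]
  refine MeasurableSet.inter (MeasurableSet.iInter fun i => measurableSet_lt (by fun_prop)
    (by fun_prop)) (MeasurableSet.iInter fun i => MeasurableSet.iInter fun j =>
    MeasurableSet.iInter fun _ => measurableSet_lt (by fun_prop) (by fun_prop))

/-- For positive weights the roots exist, interlace and are unique, so an event about the roots
becomes an event about the weights alone. -/
theorem hasSpectrumIn_rankOne_diagonal_iff {n ν : ℕ} (hν : 1 ≤ ν) {x : Fin n → ℝ}
    (hx : x ∈ orderedPositive n) (B : Set (Fin (n + 1) → ℝ)) {u : Fin (n + ν) → ℂ}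
    (hu : ∀ j, 0 < groupedWeights u j) :
    HasSpectrumIn ν B (rankOneModification (Matrix.diagonal
        (fun i => ((Fin.append x (fun _ : Fin ν => (0 : ℝ)) i : ℝ) : ℂ))) u) ↔
      groupedWeights u ∈ secularWeight (Fin.cons 0 x : Fin (n + 1) → ℝ) ''
        (B ∩ {y | Interlaces (Fin.cons 0 x : Fin (n + 1) → ℝ) y}) := by
  have ha := strictMono_cons_zero hx
  have hiff : ∀ y : Fin (n + 1) → ℝ, (rankOneModification (Matrix.diagonal
        (fun i => ((Fin.append x (fun _ : Fin ν => (0 : ℝ)) i : ℝ) : ℂ))) u).charpoly =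
      spectralPoly ν y ↔ secularPoly (Fin.cons 0 x : Fin (n + 1) → ℝ) (groupedWeights u) =
        rootPoly y := fun y => by
    rw [rankOneModification, charpoly_diagonal_append_add_vecMulVec hν, spectralPoly]
    constructor
    · intro h
      exact mul_left_cancel₀ (pow_ne_zero _ Polynomial.X_ne_zero)
        (Polynomial.map_injective _ Complex.ofRealHom.injective h)
    · intro h; rw [h]
  obtain ⟨z, hz, hzp⟩ := exists_interlaces_secularPoly_eq ha hu
  constructor
  · rintro ⟨y, ⟨hyB, hy⟩, h⟩
    have hyz : y = z := rootPoly_injOn hy.1 hz.strictMono_right (((hiff y).1 h).symm.trans hzp)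
    exact ⟨z, ⟨hyz ▸ hyB, hz⟩, secularWeight_eq_of_secularPoly_eq ha.injective hzp⟩
  · rintro ⟨y, ⟨hyB, hy⟩, h⟩
    exact ⟨y, ⟨hyB, hy.mem_orderedPositive hx⟩, (hiff y).2
      (by rw [← h, secularPoly_secularWeight ha.injective])⟩

theorem charpoly_unitary_conj {N : ℕ} {U : Matrix (Fin N) (Fin N) ℂ}
    (hU : U ∈ Matrix.unitaryGroup (Fin N) ℂ) (D : Matrix (Fin N) (Fin N) ℂ) (u : Fin N → ℂ) :
    (rankOneModification (U * D * star U) (U.mulVec u)).charpoly =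
      (rankOneModification D u).charpoly := by
  have h : rankOneModification (U * D * star U) (U.mulVec u) =
      U * rankOneModification D u * star U := by
    rw [rankOneModification, rankOneModification, mul_add, add_mul, Matrix.mul_vecMulVec,
      Matrix.vecMulVec_mul, Matrix.star_mulVec, Matrix.star_eq_conjTranspose]
  rw [h, Matrix.charpoly_mul_comm, ← mul_assoc, Matrix.mem_unitaryGroup_iff'.1 hU, one_mul]

theorem measurable_groupedWeights {n ν : ℕ} :
    Measurable (groupedWeights : (Fin (n + ν) → ℂ) → Fin (n + 1) → ℝ) := by
  have hn : Measurable Complex.normSq := Complex.continuous_normSq.measurable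
  refine measurable_pi_lambda _ (Fin.cases ?_ fun j => ?_)
  · simp only [groupedWeights, Fin.cons_zero]
    exact Finset.measurable_sum _ fun i _ => hn.comp (measurable_pi_apply _)
  · simp only [groupedWeights, Fin.cons_succ]
    exact hn.comp (measurable_pi_apply _)

theorem measurable_rankOneModification {N : ℕ} (A : Matrix (Fin N) (Fin N) ℂ) (i j : Fin N) :
    Measurable fun w : Fin N → ℂ => rankOneModification A w i j := by
  simp only [rankOneModification, Matrix.add_apply, Matrix.vecMulVec_apply, Pi.star_apply]
  fun_prop

theorem measurableSet_forall_pos (m : ℕ) : MeasurableSet {p : Fin m → ℝ | ∀ j, 0 < p j} := by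
  simp only [Set.ofPred_forall]
  exact MeasurableSet.iInter fun j => measurableSet_lt measurable_const (measurable_pi_apply j)

/-- A zero weight would leave a node as a root and break strict interlacing. -/
theorem ae_groupedWeights_pos {n ν : ℕ} (hν : 1 ≤ ν) :
    ∀ᵐ u ∂(Measure.pi fun _ : Fin (n + ν) => complexGaussian), ∀ j, 0 < groupedWeights u j := by
  refine ae_of_ae_map measurable_groupedWeights.aemeasurable (p := fun p => ∀ j, 0 < p j) ?_
  rw [map_groupedWeights_pi_complexGaussian hν]
  exact (withDensity_absolutelyContinuous _ _).ae_le
    (ae_restrict_mem (measurableSet_forall_pos (n + 1)))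

theorem ae_hasSpectrumIn_univ {n ν : ℕ} (hν : 1 ≤ ν)
    {A : Matrix (Fin (n + ν)) (Fin (n + ν)) ℂ} (hA : A.PosSemidef) {x : Fin n → ℝ}
    (hx : x ∈ orderedPositive n)
    (hxA : (Finset.univ : Finset (Fin n)).val.map x = posEigenvalues A) :
    ∀ᵐ w ∂(Measure.pi fun _ => complexGaussian),
      HasSpectrumIn ν (Set.univ : Set (Fin (n + 1) → ℝ)) (rankOneModification A w) := by
  obtain ⟨U, hU, rfl⟩ := hA.exists_unitary_diagonalization hxA
  have hUm : Measurable U.mulVec := by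
    have : Continuous U.mulVec := by fun_prop
    exact this.measurable
  rw [← map_unitary_pi_complexGaussian hU, ae_map_iff hUm.aemeasurable
    (measurableSet_hasSpectrumIn ν MeasurableSet.univ (measurable_rankOneModification _))]
  filter_upwards [ae_groupedWeights_pos hν] with u hu
  obtain ⟨z, hz, hzp⟩ := exists_interlaces_secularPoly_eq (strictMono_cons_zero hx) hu
  rw [HasSpectrumIn, charpoly_unitary_conj hU]
  exact (hasSpectrumIn_rankOne_diagonal_iff hν hx Set.univ hu).2 ⟨z, ⟨Set.mem_univ z, hz⟩,
    secularWeight_eq_of_secularPoly_eq (strictMono_cons_zero hx).injective hzp⟩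

/-- Rotate the Gaussian vector into the eigenbasis, pass to the weights, whose density is known, and
change variables to the roots. `rankOneKernel` is the Jacobian times that density with the weights
expressed through x and y. -/
theorem pi_complexGaussian_hasSpectrumIn {n ν : ℕ} (hν : 1 ≤ ν)
    {A : Matrix (Fin (n + ν)) (Fin (n + ν)) ℂ} (hA : A.PosSemidef) {x : Fin n → ℝ}
    (hx : x ∈ orderedPositive n)
    (hxA : (Finset.univ : Finset (Fin n)).val.map x = posEigenvalues A)
    {B : Set (Fin (n + 1) → ℝ)} (hB : MeasurableSet B) :
    (Measure.pi fun _ => complexGaussian) {w | HasSpectrumIn ν B (rankOneModification A w)} =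
      ∫⁻ y in B ∩ {y | Interlaces (Fin.cons 0 x : Fin (n + 1) → ℝ) y},
        ENNReal.ofReal (rankOneKernel ν x y) := by
  obtain ⟨U, hU, rfl⟩ := hA.exists_unitary_diagonalization hxA
  set a : Fin (n + 1) → ℝ := Fin.cons 0 x with ha
  have hinj := (strictMono_cons_zero hx).injective
  have hI : MeasurableSet (B ∩ {y | Interlaces a y}) :=
    hB.inter (measurable_prodMk_left (measurableSet_interlaces (n + 1)))
  have hUm : Measurable U.mulVec := by
    have : Continuous U.mulVec := by fun_prop
    exact this.measurable
  have himg := measurableSet_image_secularWeight hI Set.inter_subset_right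
  have hsub : secularWeight a '' (B ∩ {y | Interlaces a y}) ⊆ {p | ∀ j, 0 < p j} := by
    rintro _ ⟨y, hy, rfl⟩
    exact hy.2.secularWeight_pos
  have hlaw := map_groupedWeights_pi_complexGaussian (n := n) hν
  rw [← map_unitary_pi_complexGaussian hU, Measure.map_apply hUm
    (measurableSet_hasSpectrumIn ν hB (measurable_rankOneModification _))]
  have hset : (U.mulVec ⁻¹' {w | HasSpectrumIn ν B (rankOneModification (U * Matrix.diagonal
      (fun i => ((Fin.append x (fun _ : Fin ν => (0 : ℝ)) i : ℝ) : ℂ)) * star U) w)} :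
      Set (Fin (n + ν) → ℂ)) =ᵐ[Measure.pi fun _ => complexGaussian]
      (groupedWeights ⁻¹' (secularWeight a '' (B ∩ {y | Interlaces a y})) :
        Set (Fin (n + ν) → ℂ)) := by
    filter_upwards [ae_groupedWeights_pos hν] with u hu
    refine propext (Iff.trans ?_ (hasSpectrumIn_rankOne_diagonal_iff hν hx B hu))
    change HasSpectrumIn ν B _ ↔ _
    rw [HasSpectrumIn, charpoly_unitary_conj hU]
    rfl
  rw [measure_congr hset, ← Measure.map_apply measurable_groupedWeights himg, hlaw,
    withDensity_apply _ himg, Measure.restrict_restrict himg, Set.inter_eq_left.2 hsub,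
    lintegral_image_secularWeight hI Set.inter_subset_right]
  refine setLIntegral_congr_fun hI fun y hy => ?_
  have hΔ : 0 ≤ vandermondeProd y / vandermondeProd a :=
    (div_pos (vandermondeProd_pos hy.2.strictMono_right)
      (vandermondeProd_pos (strictMono_cons_zero hx))).le
  rw [← ENNReal.ofReal_mul hΔ, sum_secularWeight hinj, ha, secularWeight_cons_zero, rankOneKernel,
    Fin.sum_univ_succ (Fin.cons 0 x : Fin (n + 1) → ℝ)]
  simp

end ConditionalLaw

-- Symmetrization over permutations.

section Symmetric

variable {m : ℕ}

theorem comp_perm_eq_piCongrLeft (σ : Equiv.Perm (Fin m)) :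
    (fun x : Fin m → ℝ => x ∘ σ) = MeasurableEquiv.piCongrLeft (fun _ : Fin m => ℝ) σ.symm := by
  funext x i
  obtain ⟨j, rfl⟩ := σ.symm.surjective i
  rw [MeasurableEquiv.piCongrLeft_apply_apply]
  simp

theorem measurePreserving_comp_perm (σ : Equiv.Perm (Fin m)) :
    MeasurePreserving (fun x : Fin m → ℝ => x ∘ σ) := by
  rw [comp_perm_eq_piCongrLeft]
  exact volume_measurePreserving_piCongrLeft (fun _ : Fin m => ℝ) σ.symm

theorem measurableEmbedding_comp_perm (σ : Equiv.Perm (Fin m)) :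
    MeasurableEmbedding (fun x : Fin m → ℝ => x ∘ σ) := by
  rw [comp_perm_eq_piCongrLeft]
  exact MeasurableEquiv.measurableEmbedding _

theorem setLIntegral_comp_perm {T : Set (Fin m → ℝ)}
    (hTs : ∀ (σ : Equiv.Perm (Fin m)) x, x ∈ T ↔ x ∘ σ ∈ T) (q : (Fin m → ℝ) → ENNReal)
    (σ : Equiv.Perm (Fin m)) : ∫⁻ x in T, q (x ∘ σ) = ∫⁻ x in T, q x := by
  have hpre : (fun x : Fin m → ℝ => x ∘ σ) ⁻¹' T = T := by
    ext x; exact (hTs σ x).symm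
  have h := (measurePreserving_comp_perm σ).setLIntegral_comp_preimage_emb
    (measurableEmbedding_comp_perm σ) q T
  rwa [hpre] at h

theorem exists_perm_strictMono {x : Fin m → ℝ} (hx : Function.Injective x) :
    ∃ σ : Equiv.Perm (Fin m), StrictMono (x ∘ σ) :=
  ⟨Tuple.sort x, (Tuple.monotone_sort x).strictMono_of_injective
    (hx.comp (Tuple.sort x).injective)⟩

theorem perm_eq_of_strictMono {x : Fin m → ℝ} {σ τ : Equiv.Perm (Fin m)}
    (hσ : StrictMono (x ∘ σ)) (hτ : StrictMono (x ∘ τ)) : σ = τ := by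
  have h : x ∘ σ = x ∘ τ := Tuple.unique_monotone hσ.monotone hτ.monotone
  have hx : Function.Injective x := by
    intro i j hij
    have := hσ.injective (a₁ := σ.symm i) (a₂ := σ.symm j) (by simpa using hij)
    exact σ.symm.injective this
  ext i
  exact congrArg Fin.val (hx (congrFun h i))

theorem sum_perm_eq_single {β : Type*} [AddCommMonoid β] {g : (Fin m → ℝ) → β}
    (hg : ∀ x, ¬ StrictMono x → g x = 0) {x : Fin m → ℝ} {σ : Equiv.Perm (Fin m)}
    (hσ : StrictMono (x ∘ σ)) : ∑ τ : Equiv.Perm (Fin m), g (x ∘ τ) = g (x ∘ σ) := by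
  refine Finset.sum_eq_single σ (fun τ _ hτ => hg _ fun h => hτ ?_) (by simp)
  exact perm_eq_of_strictMono h hσ

theorem setLIntegral_sum_perm_mul {T : Set (Fin m → ℝ)}
    (hTs : ∀ (σ : Equiv.Perm (Fin m)) x, x ∈ T ↔ x ∘ σ ∈ T) {g p : (Fin m → ℝ) → ENNReal}
    (hg : Measurable g) (hp : AEMeasurable p (volume.restrict T))
    (hps : ∀ (σ : Equiv.Perm (Fin m)) x, p (x ∘ σ) = p x) :
    ∫⁻ x in T, (∑ σ : Equiv.Perm (Fin m), g (x ∘ σ)) * p x =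
      m.factorial * ∫⁻ x in T, g x * p x := by
  simp only [Finset.sum_mul]
  have hm : ∀ σ : Equiv.Perm (Fin m), AEMeasurable (fun x => g (x ∘ σ) * p x)
      (volume.restrict T) := fun σ =>
    (hg.comp (measurePreserving_comp_perm σ).measurable).aemeasurable.mul hp
  rw [lintegral_finsetSum' _ fun σ _ => hm σ]
  have h : ∀ σ : Equiv.Perm (Fin m), ∫⁻ x in T, g (x ∘ σ) * p x = ∫⁻ x in T, g x * p x :=
    fun σ => by
      rw [← setLIntegral_comp_perm hTs (fun x => g x * p x) σ]
      simp only [hps]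
  rw [Finset.sum_congr rfl fun σ _ => h σ, Finset.sum_const, Finset.card_univ, Fintype.card_perm,
    Fintype.card_fin, nsmul_eq_mul]

theorem measurableSet_strictMono (m : ℕ) : MeasurableSet {y : Fin m → ℝ | StrictMono y} := by
  have : {y : Fin m → ℝ | StrictMono y} = ⋂ i, ⋂ j, ⋂ _ : i < j, {y : Fin m → ℝ | y i < y j} := by
    ext y
    simp [StrictMono]
  rw [this]
  exact MeasurableSet.iInter fun i => MeasurableSet.iInter fun j =>
    MeasurableSet.iInter fun _ => measurableSet_lt (by fun_prop) (by fun_prop)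

/-- Symmetrizing the indicator of the increasing tuples gives 1 at every tuple with distinct
entries, since exactly one permutation sorts it. -/
theorem setLIntegral_eq_factorial_mul {T : Set (Fin m → ℝ)}
    (hTs : ∀ (σ : Equiv.Perm (Fin m)) x, x ∈ T ↔ x ∘ σ ∈ T) {p : (Fin m → ℝ) → ENNReal}
    (hp : AEMeasurable p (volume.restrict T))
    (hps : ∀ (σ : Equiv.Perm (Fin m)) x, p (x ∘ σ) = p x)
    (hp0 : ∀ x, ¬ Function.Injective x → p x = 0) :
    ∫⁻ x in T, p x = m.factorial * ∫⁻ x in T ∩ {x | StrictMono x}, p x := by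
  have hS := measurableSet_strictMono m
  have h := setLIntegral_sum_perm_mul hTs (g := {x | StrictMono x}.indicator 1)
    (measurable_one.indicator hS) hp hps
  have h1 : ∀ x : Fin m → ℝ, (∑ σ : Equiv.Perm (Fin m),
      ({x : Fin m → ℝ | StrictMono x}.indicator (1 : (Fin m → ℝ) → ENNReal)) (x ∘ σ)) * p x =
      p x := fun x => by
    by_cases hx : Function.Injective x
    · obtain ⟨σ, hσ⟩ := exists_perm_strictMono hx
      rw [sum_perm_eq_single (g := {x : Fin m → ℝ | StrictMono x}.indicator
          (1 : (Fin m → ℝ) → ENNReal)) (fun y hy => Set.indicator_of_notMem (by exact hy) _) hσ,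
        Set.indicator_of_mem (by exact hσ), Pi.one_apply, one_mul]
    · rw [hp0 x hx, mul_zero]
  simp only [h1] at h
  rw [h, Set.inter_comm, ← Measure.restrict_restrict hS, ← lintegral_indicator hS]
  congr 2
  funext x
  by_cases hx : x ∈ {x : Fin m → ℝ | StrictMono x} <;> simp [hx]

theorem polyEnsembleDensity_comp_perm (Z : ℝ) (f : Fin m → ℝ → ℝ) (x : Fin m → ℝ)
    (σ : Equiv.Perm (Fin m)) : polyEnsembleDensity Z f (x ∘ σ) = polyEnsembleDensity Z f x := by
  have hd : (Matrix.of fun j k : Fin m => f k ((x ∘ σ) j)).det =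
      (Equiv.Perm.sign σ : ℤ) * (Matrix.of fun j k : Fin m => f k (x j)).det := by
    rw [← Matrix.det_permute]
    rfl
  have hs : (((Equiv.Perm.sign σ : ℤˣ) : ℤ) : ℝ) * ((Equiv.Perm.sign σ : ℤˣ) : ℤ) = 1 := by
    rw [← Int.cast_mul, ← Units.val_mul, Int.units_mul_self]
    simp
  rw [polyEnsembleDensity, hd, vandermondeProd_comp_perm, polyEnsembleDensity]
  linear_combination (1 / Z * vandermondeProd x * (Matrix.of fun j k : Fin m => f k (x j)).det) * hs

theorem polyEnsembleDensity_eq_zero (Z : ℝ) (f : Fin m → ℝ → ℝ) {x : Fin m → ℝ}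
    (hx : ¬ Function.Injective x) : polyEnsembleDensity Z f x = 0 := by
  rw [polyEnsembleDensity, vandermondeProd_eq_zero hx, mul_zero, zero_mul]

theorem measurable_vandermondeProd : Measurable (vandermondeProd (n := m)) := by
  unfold vandermondeProd
  fun_prop

theorem aemeasurable_polyEnsembleDensity (Z : ℝ) {f : Fin m → ℝ → ℝ} {S : Set ℝ}
    (hf : ∀ k, AEMeasurable (f k) (volume.restrict S)) :
    AEMeasurable (polyEnsembleDensity Z f) (volume.restrict {x : Fin m → ℝ | ∀ j, x j ∈ S}) := by
  have hset : {x : Fin m → ℝ | ∀ j, x j ∈ S} = Set.univ.pi fun _ => S := by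
    ext x; simp
  rw [hset, volume_pi, Measure.restrict_pi_pi]
  unfold polyEnsembleDensity
  simp only [Matrix.det_apply, Matrix.of_apply]
  refine AEMeasurable.mul (measurable_const.mul measurable_vandermondeProd).aemeasurable ?_
  refine Finset.aemeasurable_fun_sum _ fun σ _ => AEMeasurable.const_smul
    (Finset.aemeasurable_fun_prod _ fun i _ => ?_) _
  exact (hf _).comp_quasiMeasurePreserving (Measure.quasiMeasurePreserving_eval _ _)

end Symmetric

-- Expectations of symmetric functions of unordered points.

section UnorderedDensity

variable {Ω : Type*} [MeasurableSpace Ω] {μ : Measure Ω} {m : ℕ} {S : Set ℝ}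
  {M : Ω → Multiset ℝ} {P : (Fin m → ℝ) → ℝ}

theorem map_comp_perm (x : Fin m → ℝ) (σ : Equiv.Perm (Fin m)) :
    (Finset.univ : Finset (Fin m)).val.map (x ∘ σ) = (Finset.univ : Finset (Fin m)).val.map x := by
  rw [← Multiset.map_map, Multiset.map_univ_val_equiv]

/-- G and F have the same law: the sets F⁻¹(T) are permutation invariant, so they are admissible
test sets for the unordered density. -/
theorem HasUnorderedDensity.lintegral_eq (h : HasUnorderedDensity μ S M P)
    (hP : AEMeasurable P (volume.restrict {x : Fin m → ℝ | ∀ j, x j ∈ S}))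
    {F : (Fin m → ℝ) → ENNReal} (hF : Measurable F)
    (hFs : ∀ (σ : Equiv.Perm (Fin m)) x, F (x ∘ σ) = F x) {G : Ω → ENNReal}
    (hG : AEMeasurable G μ)
    (hGF : ∀ᵐ ω ∂μ, ∃ x, (Finset.univ : Finset (Fin m)).val.map x = M ω ∧ G ω = F x) :
    ∫⁻ ω, G ω ∂μ = ∫⁻ x in {x | ∀ j, x j ∈ S}, F x * ENNReal.ofReal (P x) := by
  set ρ := (volume.restrict {x : Fin m → ℝ | ∀ j, x j ∈ S}).withDensity
    fun x => ENNReal.ofReal (P x) with hρ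
  have hmap : μ.map G = ρ.map F := by
    ext T hT
    have hFT := hF hT
    rw [Measure.map_apply_of_aemeasurable hG hT, Measure.map_apply hF hT, hρ,
      withDensity_apply _ hFT, Measure.restrict_restrict hFT,
      ← h (F ⁻¹' T) hFT (fun σ x hx => by rw [Set.mem_preimage, hFs]; exact hx)]
    refine measure_congr ?_
    filter_upwards [hGF] with ω hω
    obtain ⟨x, hx, hGx⟩ := hω
    refine propext ⟨fun hω => ⟨x, ?_, hx⟩, ?_⟩
    · change F x ∈ T
      rw [← hGx]; exact hω
    · rintro ⟨y, hy, hyM⟩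
      obtain ⟨σ, rfl⟩ := exists_perm_of_map_eq (hyM.trans hx.symm)
      change G ω ∈ T
      rw [hGx, ← hFs σ]
      exact hy
  rw [← lintegral_map' aemeasurable_id' hG, hmap, lintegral_map measurable_id' hF, hρ,
    lintegral_withDensity_eq_lintegral_mul₀ hP.ennreal_ofReal hF.aemeasurable]
  simp only [Pi.mul_apply, mul_comm]

/-- The tuples with a repeated entry form a permutation-invariant set on which the density vanishes,
so the points are almost surely distinct and can be sorted. -/
theorem HasUnorderedDensity.ae_exists_strictMono (h : HasUnorderedDensity μ S M P)
    (hS : MeasurableSet {x : Fin m → ℝ | ∀ j, x j ∈ S})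
    (hP0 : ∀ x, ¬ Function.Injective x → P x = 0)
    (hcard : ∀ᵐ ω ∂μ, (M ω).card = m) :
    ∀ᵐ ω ∂μ, ∃ x : Fin m → ℝ, StrictMono x ∧
      (Finset.univ : Finset (Fin m)).val.map x = M ω := by
  have hm : MeasurableSet {x : Fin m → ℝ | ¬ Function.Injective x} := by
    have : {x : Fin m → ℝ | ¬ Function.Injective x} =
        ⋃ i, ⋃ j, ⋃ _ : i ≠ j, {x : Fin m → ℝ | x i = x j} := by
      ext x
      simp [Function.Injective]
      tauto
    rw [this]
    exact MeasurableSet.iUnion fun i => MeasurableSet.iUnion fun j => MeasurableSet.iUnion fun _ =>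
      measurableSet_eq_fun (measurable_pi_apply i) (measurable_pi_apply j)
  have h0 := h {x | ¬ Function.Injective x} hm (fun σ x hx hinj => hx (by
    have := hinj.comp σ.symm.injective
    rwa [Function.comp_assoc, Equiv.self_comp_symm, Function.comp_id] at this))
  rw [setLIntegral_eq_zero (hm.inter hS) fun x hx => by simp [hP0 x hx.1]] at h0
  filter_upwards [hcard, measure_eq_zero_iff_ae_notMem.1 h0] with ω hω hω0
  obtain ⟨x, hx⟩ : ∃ x : Fin m → ℝ, (Finset.univ : Finset (Fin m)).val.map x = M ω := by
    obtain ⟨l, hl⟩ := Quot.exists_rep (M ω)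
    have hlen : l.length = m := by rw [← hω, ← hl]; rfl
    subst hlen
    refine ⟨l.get, ?_⟩
    rw [Fin.univ_val_map, List.ofFn_get]
    exact hl
  have hinj : Function.Injective x := by
    by_contra hni
    exact hω0 ⟨x, hni, hx⟩
  obtain ⟨σ, hσ⟩ := exists_perm_strictMono hinj
  exact ⟨x ∘ σ, hσ, (map_comp_perm x σ).trans hx⟩

end UnorderedDensity

-- Integrating out x over the interlacing box.

section InterlacingIntegral

variable {n : ℕ}

/-- For fixed y the constraints on x decouple into a product of intervals, which lets the
determinant be integrated row by row. -/
theorem mem_orderedPositive_and_interlaces_iff {x : Fin n → ℝ} {y : Fin (n + 1) → ℝ}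
    (hy : y ∈ orderedPositive (n + 1)) :
    x ∈ orderedPositive n ∧ Interlaces (Fin.cons 0 x : Fin (n + 1) → ℝ) y ↔
      x ∈ Set.univ.pi fun j : Fin n => Set.Ioo (y j.castSucc) (y j.succ) := by
  rw [Set.mem_univ_pi]
  constructor
  · rintro ⟨-, h1, h2⟩ j
    exact ⟨by simpa using h2 j.castSucc j.succ Fin.castSucc_lt_succ, by simpa using h1 j.succ⟩
  · intro h
    have hpos : ∀ j, 0 < x j := fun j => (hy.2 _).trans (h j).1
    refine ⟨⟨fun i j hij => ?_, hpos⟩, fun i => ?_, fun i j hij => ?_⟩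
    · exact ((h i).2.trans_le (hy.1.monotone (Fin.succ_le_castSucc_iff.2 hij))).trans (h j).1
    · induction i using Fin.cases with
      | zero => simpa using hy.2 0
      | succ i => simpa using (h i).2
    · induction j using Fin.cases with
      | zero => exact absurd hij (Fin.not_lt_zero i)
      | succ j =>
        rw [Fin.cons_succ]
        exact (hy.1.monotone (Fin.le_castSucc_iff.2 hij)).trans_lt (h j).1

theorem det_eq_sum_prod (A : Matrix (Fin n) (Fin n) ℝ) :
    A.det = ∑ σ : Equiv.Perm (Fin n), ((Equiv.Perm.sign σ : ℤ) : ℝ) * ∏ i, A i (σ i) := by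
  rw [← Matrix.det_transpose, Matrix.det_apply']
  rfl

theorem integrableOn_pi_det {h : Fin n → ℝ → ℝ} {I : Fin n → Set ℝ}
    (hI : ∀ j k, IntegrableOn (h k) (I j)) :
    IntegrableOn (fun x : Fin n → ℝ => (Matrix.of fun j k : Fin n => h k (x j)).det)
      (Set.univ.pi I) := by
  rw [IntegrableOn, volume_pi, Measure.restrict_pi_pi]
  simp only [det_eq_sum_prod, Matrix.of_apply]
  exact integrable_finsetSum _ fun σ _ => Integrable.const_mul
    (Integrable.fintype_prod (μ := fun i => volume.restrict (I i)) (f := fun i t => h (σ i) t) fun i => hI i (σ i)) _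

theorem setIntegral_pi_det {h : Fin n → ℝ → ℝ} {I : Fin n → Set ℝ}
    (hI : ∀ j k, IntegrableOn (h k) (I j)) :
    ∫ x in Set.univ.pi I, (Matrix.of fun j k : Fin n => h k (x j)).det =
      (Matrix.of fun j k : Fin n => ∫ t in I j, h k t).det := by
  rw [volume_pi, Measure.restrict_pi_pi]
  simp only [det_eq_sum_prod, Matrix.of_apply]
  rw [integral_finsetSum _ fun (σ : Equiv.Perm (Fin n)) _ => Integrable.const_mul
    (Integrable.fintype_prod (μ := fun i => volume.restrict (I i)) (f := fun i t => h (σ i) t) fun i => hI i (σ i)) _]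
  refine Finset.sum_congr rfl fun σ _ => ?_
  rw [integral_const_mul, integral_fintype_prod_eq_prod (fun i t => h (σ i) t)]

/-- Subtract from each row its predecessor: the column of ones becomes the first unit vector, and
expansion along it leaves the differences. -/
theorem det_cons_one (G : Fin n → Fin (n + 1) → ℝ) :
    (Matrix.of fun i k : Fin (n + 1) => (Fin.cons 1 (fun k => G k i) : Fin (n + 1) → ℝ) k).det =
      (Matrix.of fun j k : Fin n => G k j.succ - G k j.castSucc).det := by
  set A : Matrix (Fin (n + 1)) (Fin (n + 1)) ℝ :=
    Matrix.of fun i k => (Fin.cons 1 (fun k => G k i) : Fin (n + 1) → ℝ) k with hA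
  set B : Matrix (Fin (n + 1)) (Fin (n + 1)) ℝ :=
    Matrix.of fun i k => (Fin.cons (A 0 k) (fun j => A j.succ k - A j.castSucc k) :
      Fin (n + 1) → ℝ) i with hB
  have hAB : A.det = B.det := Matrix.det_eq_of_forall_row_eq_smul_add_pred (fun _ => 1)
    (fun k => by simp [hB]) (fun i k => by simp [hB])
  rw [hAB, Matrix.det_succ_column_zero, Finset.sum_eq_single 0]
  · simp only [Fin.val_zero, pow_zero, one_mul]
    have h0 : B 0 0 = 1 := by simp [hB, hA]
    rw [h0, one_mul]
    rfl
  · intro i _ hi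
    obtain ⟨j, rfl⟩ := Fin.exists_succ_eq.2 hi
    have : B j.succ 0 = 0 := by simp [hB, hA]
    rw [this]
    ring
  · simp

theorem det_rankOneFunctions (ν : ℕ) (c : ℝ) (f : Fin n → ℝ → ℝ) (y : Fin (n + 1) → ℝ) :
    (Matrix.of fun i k : Fin (n + 1) => rankOneFunctions ν c f k (y i)).det =
      (∏ i, (y i ^ (ν - 1) * Real.exp (-y i))) * (Matrix.of fun j k : Fin n =>
        (∫ x in c..y j.succ, x ^ (-(ν : ℤ)) * Real.exp x * f k x) -
          ∫ x in c..y j.castSucc, x ^ (-(ν : ℤ)) * Real.exp x * f k x).det := by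
  rw [← det_cons_one (fun k i => ∫ x in c..y i, x ^ (-(ν : ℤ)) * Real.exp x * f k x),
    ← Matrix.det_mul_column]
  congr 1
  ext i k
  refine Fin.cases ?_ (fun k => ?_) k
  · simp [rankOneFunctions]
  · simp [rankOneFunctions]

variable {ν : ℕ} {c Z : ℝ} {f : Fin n → ℝ → ℝ}

/-- The Vandermonde factor Δ(x) cancels against Δ(0, x) = ∏ x · Δ(x). The leftover ∏ x^(-1) joins ∏
x^(-(ν-1)) from the Gamma density to give the exponent -ν. -/
theorem rankOneKernel_mul_polyEnsembleDensity (hν : 1 ≤ ν) {x : Fin n → ℝ}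
    (hx : x ∈ orderedPositive n) (y : Fin (n + 1) → ℝ) :
    rankOneKernel ν x y * polyEnsembleDensity Z f x =
      1 / (Z * (ν - 1).factorial) * vandermondeProd y * (∏ i, (y i ^ (ν - 1) * Real.exp (-y i))) *
        (Matrix.of fun j k : Fin n => x j ^ (-(ν : ℤ)) * Real.exp (x j) * f k (x j)).det := by
  have h1 : (Matrix.of fun j k : Fin n => x j ^ (-(ν : ℤ)) * Real.exp (x j) * f k (x j)).det =
      (∏ j, (x j ^ (-(ν : ℤ)) * Real.exp (x j))) * (Matrix.of fun j k : Fin n => f k (x j)).det :=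
    Matrix.det_mul_column _ _
  have hΔ := (vandermondeProd_pos hx.1).ne'
  have hX : (∏ j, x j) ≠ 0 := (Finset.prod_pos fun j _ => hx.2 j).ne'
  obtain ⟨k, rfl⟩ : ∃ k, ν = k + 1 := ⟨ν - 1, by omega⟩
  rw [h1, rankOneKernel, polyEnsembleDensity, vandermondeProd_cons_zero, Finset.prod_mul_distrib,
    Finset.prod_mul_distrib, ← Real.exp_sum, ← Real.exp_sum, Finset.sum_neg_distrib, neg_sub,
    Real.exp_sub, Finset.prod_pow, Nat.add_sub_cancel, Real.exp_neg]
  have h2 : ∏ j, x j ^ (-((k + 1 : ℕ) : ℤ)) = ((∏ j, x j) ^ (k + 1))⁻¹ := by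
    rw [← Finset.prod_pow, ← Finset.prod_inv_distrib]
    exact Finset.prod_congr rfl fun j _ => by rw [zpow_neg, zpow_natCast]
  rw [h2]
  -- With Z = 0 both sides vanish, since 1 / 0 = 0.
  rcases eq_or_ne Z 0 with rfl | hZ
  · simp
  rw [div_pow]
  field_simp
  ring

theorem intervalIntegrable_rankOne_integrand (hf : ∀ k, IntegrableOn (f k) (Set.Ioi 0))
    (k : Fin n) {a b : ℝ} (ha : 0 < a) (hb : 0 < b) :
    IntervalIntegrable (fun x : ℝ => x ^ (-(ν : ℤ)) * Real.exp x * f k x) volume a b := by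
  have hsub : Set.uIcc a b ⊆ Set.Ioi 0 := fun t ht => (lt_min ha hb).trans_le ht.1
  refine IntervalIntegrable.continuousOn_mul (f := f k) ?_ ?_
  · rw [intervalIntegrable_iff]
    exact (hf k).mono_set (Set.uIoc_subset_uIcc.trans hsub)
  · refine ContinuousOn.mul (ContinuousOn.zpow₀ continuousOn_id _ fun t ht => Or.inl ?_)
      Real.continuous_exp.continuousOn
    exact (hsub ht).ne'

theorem setIntegral_box_eq_polyEnsembleDensity (hc : 0 < c)
    (hf : ∀ k, IntegrableOn (f k) (Set.Ioi 0)) {y : Fin (n + 1) → ℝ}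
    (hy : y ∈ orderedPositive (n + 1)) :
    IntegrableOn (fun x : Fin n → ℝ =>
        (Matrix.of fun j k : Fin n => x j ^ (-(ν : ℤ)) * Real.exp (x j) * f k (x j)).det)
        (Set.univ.pi fun j : Fin n => Set.Ioo (y j.castSucc) (y j.succ)) ∧
    1 / (Z * (ν - 1).factorial) * vandermondeProd y * (∏ i, (y i ^ (ν - 1) * Real.exp (-y i))) *
      ∫ x in Set.univ.pi fun j : Fin n => Set.Ioo (y j.castSucc) (y j.succ),
        (Matrix.of fun j k : Fin n => x j ^ (-(ν : ℤ)) * Real.exp (x j) * f k (x j)).det =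
      (n + 1) * polyEnsembleDensity (Z * (ν - 1).factorial * (n + 1)) (rankOneFunctions ν c f) y := by
  have hI : ∀ a b, 0 < a → 0 < b → ∀ k, IntervalIntegrable
      (fun x : ℝ => x ^ (-(ν : ℤ)) * Real.exp x * f k x) volume a b :=
    fun a b ha hb k => intervalIntegrable_rankOne_integrand hf k ha hb
  have hlt : ∀ j : Fin n, y j.castSucc < y j.succ := fun j => hy.1 Fin.castSucc_lt_succ
  have hO : ∀ (j k : Fin n), IntegrableOn (fun x : ℝ => x ^ (-(ν : ℤ)) * Real.exp x * f k x)
      (Set.Ioo (y j.castSucc) (y j.succ)) := fun j k =>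
    ((intervalIntegrable_iff_integrableOn_Ioo_of_le (hlt j).le).1 (hI _ _ (hy.2 _) (hy.2 _) k))
  refine ⟨integrableOn_pi_det (h := fun k x => x ^ (-(ν : ℤ)) * Real.exp x * f k x) hO, ?_⟩
  rw [setIntegral_pi_det (h := fun k x => x ^ (-(ν : ℤ)) * Real.exp x * f k x) hO,
    polyEnsembleDensity, det_rankOneFunctions]
  -- The base point c drops out here: only differences of the primitives enter.
  have hd : (Matrix.of fun j k : Fin n =>
        (∫ x in c..y j.succ, x ^ (-(ν : ℤ)) * Real.exp x * f k x) -
          ∫ x in c..y j.castSucc, x ^ (-(ν : ℤ)) * Real.exp x * f k x) =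
      Matrix.of fun j k : Fin n => ∫ t in Set.Ioo (y j.castSucc) (y j.succ),
        t ^ (-(ν : ℤ)) * Real.exp t * f k t := by
    ext j k
    rw [Matrix.of_apply, Matrix.of_apply, intervalIntegral.integral_interval_sub_left
      (hI _ _ hc (hy.2 _) k) (hI _ _ hc (hy.2 _) k), intervalIntegral.integral_of_le (hlt j).le,
      integral_Ioc_eq_integral_Ioo]
  rw [hd]
  have hn : (n : ℝ) + 1 ≠ 0 := by positivity
  rcases eq_or_ne Z 0 with rfl | hZ
  · simp
  field_simp

theorem rankOneKernel_nonneg {x : Fin n → ℝ} {y : Fin (n + 1) → ℝ} (hx : x ∈ orderedPositive n)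
    (hy : y ∈ orderedPositive (n + 1)) : 0 ≤ rankOneKernel ν x y := by
  have h1 := vandermondeProd_pos (strictMono_cons_zero hx)
  have h2 := vandermondeProd_pos hy.1
  have h3 : 0 < ∏ j, x j := Finset.prod_pos fun j _ => hx.2 j
  have h4 : 0 < ∏ i, y i := Finset.prod_pos fun i _ => hy.2 i
  unfold rankOneKernel
  positivity

/-- Both claims come from one identity: the new density, times n + 1, is the Bochner integral of a
nonnegative function over the box. Nonnegativity is what allows the passage to the lower integral.
-/
theorem setLIntegral_rankOneKernel_mul (hν : 1 ≤ ν) (hc : 0 < c)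
    (hf : ∀ k, IntegrableOn (f k) (Set.Ioi 0))
    (hP : ∀ x : Fin n → ℝ, (∀ j, 0 < x j) → 0 ≤ polyEnsembleDensity Z f x)
    {y : Fin (n + 1) → ℝ} (hy : y ∈ orderedPositive (n + 1)) :
    0 ≤ polyEnsembleDensity (Z * (ν - 1).factorial * (n + 1)) (rankOneFunctions ν c f) y ∧
    ∫⁻ x in Set.univ.pi fun j : Fin n => Set.Ioo (y j.castSucc) (y j.succ),
      ENNReal.ofReal (rankOneKernel ν x y) * ENNReal.ofReal (polyEnsembleDensity Z f x) =
      ((n + 1 : ℕ) : ENNReal) * ENNReal.ofReal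
        (polyEnsembleDensity (Z * (ν - 1).factorial * (n + 1)) (rankOneFunctions ν c f) y) := by
  obtain ⟨hint, heq⟩ := setIntegral_box_eq_polyEnsembleDensity (ν := ν) (Z := Z) hc hf hy
  have hbox : MeasurableSet (Set.univ.pi fun j : Fin n => Set.Ioo (y j.castSucc) (y j.succ)) :=
    MeasurableSet.univ_pi fun _ => measurableSet_Ioo
  have hx : ∀ x ∈ Set.univ.pi fun j : Fin n => Set.Ioo (y j.castSucc) (y j.succ),
      x ∈ orderedPositive n := fun x hx => ((mem_orderedPositive_and_interlaces_iff hy).2 hx).1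
  set C := 1 / (Z * (ν - 1).factorial) * vandermondeProd y *
    (∏ i, (y i ^ (ν - 1) * Real.exp (-y i)))
  have hpos : ∀ x ∈ Set.univ.pi fun j : Fin n => Set.Ioo (y j.castSucc) (y j.succ),
      0 ≤ C * (Matrix.of fun j k : Fin n => x j ^ (-(ν : ℤ)) * Real.exp (x j) * f k (x j)).det := by
    intro x hxb
    rw [← rankOneKernel_mul_polyEnsembleDensity hν (hx x hxb)]
    exact mul_nonneg (rankOneKernel_nonneg (hx x hxb) hy) (hP x (hx x hxb).2)
  rw [← integral_const_mul] at heq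
  have h0 := setIntegral_nonneg (μ := volume) hbox hpos
  rw [heq] at h0
  have hn : (0 : ℝ) < (n : ℝ) + 1 := by positivity
  refine ⟨(mul_nonneg_iff_of_pos_left hn).1 h0, ?_⟩
  have hco : ((n + 1 : ℕ) : ENNReal) = ENNReal.ofReal ((n : ℝ) + 1) := by
    rw [← ENNReal.ofReal_natCast]; push_cast; rfl
  rw [hco, ← ENNReal.ofReal_mul hn.le, ← heq, ofReal_integral_eq_lintegral_ofReal (hint.const_mul C)
    ((ae_restrict_iff' hbox).2 (Filter.Eventually.of_forall hpos))]
  refine setLIntegral_congr_fun hbox fun x hxb => ?_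
  rw [← ENNReal.ofReal_mul (rankOneKernel_nonneg (hx x hxb) hy),
    rankOneKernel_mul_polyEnsembleDensity hν (hx x hxb)]

theorem polyEnsembleDensity_rankOne_nonneg (hν : 1 ≤ ν) (hc : 0 < c)
    (hf : ∀ k, IntegrableOn (f k) (Set.Ioi 0))
    (hP : ∀ x : Fin n → ℝ, (∀ j, 0 < x j) → 0 ≤ polyEnsembleDensity Z f x)
    {y : Fin (n + 1) → ℝ} (hy : ∀ i, 0 < y i) :
    0 ≤ polyEnsembleDensity (Z * (ν - 1).factorial * (n + 1)) (rankOneFunctions ν c f) y := by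
  by_cases hinj : Function.Injective y
  · obtain ⟨σ, hσ⟩ := exists_perm_strictMono hinj
    rw [← polyEnsembleDensity_comp_perm _ _ y σ]
    exact (setLIntegral_rankOneKernel_mul hν hc hf hP ⟨hσ, fun i => hy (σ i)⟩).1
  · rw [polyEnsembleDensity_eq_zero _ _ hinj]

end InterlacingIntegral

-- Moments of the new functions.

section Integrability

theorem integrableOn_pow_mul_exp_neg (a : ℕ) :
    IntegrableOn (fun t : ℝ => t ^ a * Real.exp (-t)) (Set.Ioi 0) := by
  refine (Real.GammaIntegral_convergent (s := a + 1) (by positivity)).congr_fun (fun t _ => ?_)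
    measurableSet_Ioi
  simp only
  rw [add_sub_cancel_right, Real.rpow_natCast, mul_comm]

/-- Write y = x + t. For x > c one has x + t ≤ (1 + t/c) x, so x^a e^(-x) factors out and D is an
integral in t alone. -/
theorem exists_setLIntegral_Ici_pow_mul_exp_neg_le (a : ℕ) {c : ℝ} (hc : 0 < c) :
    ∃ D : ENNReal, D ≠ ⊤ ∧ ∀ x, c < x → ∫⁻ y in Set.Ici x, ENNReal.ofReal (y ^ a * Real.exp (-y)) ≤
      D * ENNReal.ofReal (x ^ a * Real.exp (-x)) := by
  have hint : IntegrableOn (fun t : ℝ => (1 + t / c) ^ a * Real.exp (-t)) (Set.Ioi 0) := by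
    have hb : IntegrableOn (fun t : ℝ => 2 ^ (a - 1) * (t ^ 0 * Real.exp (-t) +
        (c ^ a)⁻¹ * (t ^ a * Real.exp (-t)))) (Set.Ioi 0) :=
      ((integrableOn_pow_mul_exp_neg 0).add ((integrableOn_pow_mul_exp_neg a).const_mul _)).const_mul _
    refine Integrable.mono' hb (by fun_prop) ?_
    filter_upwards [ae_restrict_mem measurableSet_Ioi] with t ht
    have ht : 0 < t := ht
    have h := add_pow_le zero_le_one (by positivity : 0 ≤ t / c) a
    rw [Real.norm_of_nonneg (by positivity)]
    calc (1 + t / c) ^ a * Real.exp (-t) ≤ 2 ^ (a - 1) * (1 ^ a + (t / c) ^ a) * Real.exp (-t) := by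
          gcongr
      _ = _ := by rw [div_pow]; ring
  refine ⟨∫⁻ t in Set.Ici 0, ENNReal.ofReal ((1 + t / c) ^ a * Real.exp (-t)), ?_, fun x hx => ?_⟩
  · rw [setLIntegral_congr Ioi_ae_eq_Ici.symm]
    exact (Integrable.lintegral_lt_top hint).ne
  · rw [← lintegral_mul_const _ (by fun_prop), ← lintegral_indicator measurableSet_Ici,
      ← lintegral_indicator measurableSet_Ici,
      ← lintegral_add_right_eq_self ((Set.Ici x).indicator _) x]
    refine lintegral_mono fun t => ?_
    by_cases ht : 0 ≤ t
    · have hx0 : 0 < x := hc.trans hx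
      rw [Set.indicator_of_mem (by simpa using ht), Set.indicator_of_mem (by simpa using ht),
        ← ENNReal.ofReal_mul (by positivity)]
      apply ENNReal.ofReal_le_ofReal
      have h1 : t + x ≤ (1 + t / c) * x := by
        have : t ≤ t / c * x := by
          rw [div_mul_eq_mul_div, le_div_iff₀ hc]
          exact mul_le_mul_of_nonneg_left hx.le ht
        linarith
      calc (t + x) ^ a * Real.exp (-(t + x)) ≤ ((1 + t / c) * x) ^ a * Real.exp (-(t + x)) := by
            gcongr
        _ = _ := by rw [mul_pow, neg_add, Real.exp_add]; ring
    · rw [Set.indicator_of_notMem (by simpa using ht)]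
      exact zero_le

variable {n ν : ℕ} {c : ℝ} {f : Fin n → ℝ → ℝ}

theorem continuousOn_rankOneFunctions (hc : 0 < c) (hf : ∀ k, IntegrableOn (f k) (Set.Ioi 0))
    (k : Fin (n + 1)) : ContinuousOn (rankOneFunctions ν c f k) (Set.Ioi 0) := by
  induction k using Fin.cases with
  | zero =>
    simp only [rankOneFunctions, Fin.cons_zero]
    fun_prop
  | succ k =>
    simp only [rankOneFunctions, Fin.cons_succ]
    refine ContinuousOn.mul (by fun_prop) fun y hy => ?_
    have hy : 0 < y := hy
    -- The compact interval [min(c,y)/2, max(c,y)+1] lies in (0, ∞), contains c and has y in its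
    -- interior.
    have hm : 0 < min c y / 2 := by positivity
    have h1 : min c y / 2 < min c y := half_lt_self (by positivity)
    have h2 : max c y < max c y + 1 := lt_add_one _
    have hle : min c y / 2 ≤ max c y + 1 := by
      have := min_le_max (a := c) (b := y); linarith
    have h := intervalIntegral.continuousOn_primitive_interval'
      (intervalIntegrable_rankOne_integrand (ν := ν) hf k hm
        (lt_of_lt_of_le hc ((le_max_left c y).trans h2.le)))
      (a := c) (by rw [Set.uIcc_of_le hle]
                   exact ⟨h1.le.trans (min_le_left _ _), (le_max_left _ _).trans h2.le⟩)
    rw [Set.uIcc_of_le hle] at h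
    exact (h.continuousAt (Icc_mem_nhds (h1.trans_le (min_le_right _ _))
      ((le_max_right _ _).trans_lt h2))).continuousWithinAt

/-- This is the inner integral after Tonelli. For x ≤ c only y < x contributes, and the bound is
constant; for x > c only y ≥ x does, and the tail estimate gives x^(j-1), one power less than j. -/
theorem exists_setLIntegral_uIoc_pow_mul_exp_neg_le (j : ℕ) (hν : 1 ≤ ν) (hc : 0 < c) :
    ∃ C : ENNReal, C ≠ ⊤ ∧ ∀ x, 0 < x →
      ENNReal.ofReal (x ^ (-(ν : ℤ)) * Real.exp x) * ∫⁻ y in Set.Ioi 0 ∩ {y | x ∈ Set.uIoc c y},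
        ENNReal.ofReal (y ^ (j + (ν - 1)) * Real.exp (-y)) ≤
      C * ENNReal.ofReal (1 + x ^ (j - 1)) := by
  obtain ⟨D, hD, hDle⟩ := exists_setLIntegral_Ici_pow_mul_exp_neg_le (j + (ν - 1)) hc
  obtain ⟨k, rfl⟩ : ∃ k, ν = k + 1 := ⟨ν - 1, by omega⟩
  rw [Nat.add_sub_cancel] at *
  refine ⟨ENNReal.ofReal (Real.exp c * c ^ j) + D * ENNReal.ofReal (1 + c⁻¹),
    by finiteness, fun x hx => ?_⟩
  rcases le_or_gt x c with hxc | hxc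
  · have hsub : Set.Ioi 0 ∩ {y | x ∈ Set.uIoc c y} ⊆ Set.Ioo 0 x := by
      rintro y ⟨hy0, hy⟩
      refine ⟨hy0, ?_⟩
      rcases min_lt_iff.1 hy.1 with h | h
      · exact absurd h (not_lt.2 hxc)
      · exact h
    have h1 : ∫⁻ y in Set.Ioi 0 ∩ {y | x ∈ Set.uIoc c y},
        ENNReal.ofReal (y ^ (j + k) * Real.exp (-y)) ≤ ENNReal.ofReal (x ^ (j + k) * x) := by
      refine (lintegral_mono_set hsub).trans ?_
      refine (setLIntegral_mono (g := fun _ => ENNReal.ofReal (x ^ (j + k))) measurable_const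
        fun y hy => ENNReal.ofReal_le_ofReal ?_).trans ?_
      · have hy0 := hy.1
        calc y ^ (j + k) * Real.exp (-y) ≤ x ^ (j + k) * 1 := by
              gcongr
              · exact hy.2.le
              · exact Real.exp_le_one_iff.2 (by linarith)
          _ = _ := mul_one _
      · rw [setLIntegral_const, Real.volume_Ioo, sub_zero, ENNReal.ofReal_mul (by positivity)]
    calc _ ≤ ENNReal.ofReal (x ^ (-((k + 1 : ℕ) : ℤ)) * Real.exp x) *
          ENNReal.ofReal (x ^ (j + k) * x) := by gcongr
      _ = ENNReal.ofReal (Real.exp x * x ^ j) := by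
          rw [← ENNReal.ofReal_mul (by positivity), zpow_neg, zpow_natCast]
          congr 1
          field_simp
          ring
      _ ≤ ENNReal.ofReal (Real.exp c * c ^ j) := by
          apply ENNReal.ofReal_le_ofReal; gcongr
      _ ≤ (ENNReal.ofReal (Real.exp c * c ^ j) + D * ENNReal.ofReal (1 + c⁻¹)) * 1 := by
          rw [mul_one]; exact le_self_add
      _ ≤ _ := by
          gcongr
          rw [← ENNReal.ofReal_one]
          apply ENNReal.ofReal_le_ofReal
          have : 0 ≤ x ^ (j - 1) := by positivity
          linarith
  · have hsub : Set.Ioi 0 ∩ {y | x ∈ Set.uIoc c y} ⊆ Set.Ici x := by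
      rintro y ⟨-, hy⟩
      rcases le_max_iff.1 hy.2 with h | h
      · exact absurd hxc (not_lt.2 h)
      · exact h
    calc _ ≤ ENNReal.ofReal (x ^ (-((k + 1 : ℕ) : ℤ)) * Real.exp x) *
          (D * ENNReal.ofReal (x ^ (j + k) * Real.exp (-x))) := by
          gcongr
          exact (lintegral_mono_set hsub).trans (hDle x hxc)
      _ = D * ENNReal.ofReal (x ^ j * x⁻¹) := by
          rw [mul_left_comm, ← ENNReal.ofReal_mul (by positivity), zpow_neg, zpow_natCast,
            Real.exp_neg]
          congr 2
          field_simp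
          ring
      _ ≤ D * ENNReal.ofReal ((1 + c⁻¹) * (1 + x ^ (j - 1))) := by
          refine mul_le_mul' le_rfl (ENNReal.ofReal_le_ofReal ?_)
          have hci : 0 < c⁻¹ := inv_pos.2 hc
          rcases j with - | j
          -- Here j = 0, where j - 1 is truncated to 0; the true power x^(-1) is bounded because x >
          -- c.
          · have : x⁻¹ ≤ c⁻¹ := by gcongr
            simp
            nlinarith
          · rw [pow_succ, mul_assoc, mul_inv_cancel₀ hx.ne', mul_one, Nat.add_sub_cancel]
            have : 0 < x ^ j := by positivity
            nlinarith [mul_pos hci this]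
      _ ≤ _ := by
          rw [ENNReal.ofReal_mul (by positivity), ← mul_assoc]
          gcongr
          exact le_add_self

/-- Bound the inner integral by that of the absolute value and swap the order. The power gained in
the tail estimate is essential: j may equal n, while moments of f are available only up to n - 1. -/
theorem integrableOn_pow_mul_rankOneFunctions (hν : 1 ≤ ν) (hc : 0 < c)
    (hf : ∀ j k : Fin n, IntegrableOn (fun x : ℝ => x ^ (j : ℕ) * f k x) (Set.Ioi 0))
    (hf0 : ∀ k, IntegrableOn (f k) (Set.Ioi 0)) (j k : Fin (n + 1)) :
    IntegrableOn (fun y : ℝ => y ^ (j : ℕ) * rankOneFunctions ν c f k y) (Set.Ioi 0) := by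
  have hmeas : AEStronglyMeasurable (fun y : ℝ => y ^ (j : ℕ) * rankOneFunctions ν c f k y)
      (volume.restrict (Set.Ioi 0)) :=
    (ContinuousOn.mul (by fun_prop)
      (continuousOn_rankOneFunctions hc hf0 k)).aestronglyMeasurable measurableSet_Ioi
  induction k using Fin.cases with
  | zero =>
    refine (integrableOn_pow_mul_exp_neg (j + (ν - 1))).congr_fun (fun y _ => ?_) measurableSet_Ioi
    simp [rankOneFunctions, pow_add, mul_assoc]
  | succ k =>
    refine ⟨hmeas, ?_⟩
    set w : ℝ → ℝ := fun x => x ^ (-(ν : ℤ)) * Real.exp x * f k x with hw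
    obtain ⟨C, hC, hCle⟩ := exists_setLIntegral_uIoc_pow_mul_exp_neg_le (c := c) (j : ℕ) hν hc
    have hfm : AEMeasurable (fun x => ‖f k x‖ₑ) (volume.restrict (Set.Ioi 0)) :=
      (hf0 k).1.enorm
    have hwm : AEMeasurable (fun x => ‖w x‖ₑ) (volume.restrict (Set.Ioi 0)) := by
      refine AEMeasurable.enorm (AEMeasurable.mul (Measurable.aemeasurable ?_) (hf0 k).1.aemeasurable)
      fun_prop
    have hR : MeasurableSet {q : ℝ × ℝ | q.2 ∈ Set.uIoc c q.1} := by
      have : {q : ℝ × ℝ | q.2 ∈ Set.uIoc c q.1} =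
          {q | min c q.1 < q.2} ∩ {q | q.2 ≤ max c q.1} := rfl
      rw [this]
      exact (measurableSet_lt (by fun_prop) (by fun_prop)).inter
        (measurableSet_le (by fun_prop) (by fun_prop))
    have hb : ∀ y ∈ Set.Ioi (0 : ℝ), ‖y ^ (j : ℕ) * rankOneFunctions ν c f k.succ y‖ₑ ≤
        ∫⁻ x in Set.Ioi 0, {q : ℝ × ℝ | q.2 ∈ Set.uIoc c q.1}.indicator
          (fun q => ENNReal.ofReal (q.1 ^ ((j : ℕ) + (ν - 1)) * Real.exp (-q.1)) * ‖w q.2‖ₑ) (y, x) := by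
      intro y hy
      have hy : 0 < y := hy
      have hsub : Set.uIoc c y ⊆ Set.Ioi 0 := fun x hx => (lt_min hc hy).trans hx.1
      have h1 : y ^ (j : ℕ) * rankOneFunctions ν c f k.succ y =
          y ^ ((j : ℕ) + (ν - 1)) * Real.exp (-y) * ∫ x in c..y, w x := by
        simp only [rankOneFunctions, Fin.cons_succ, hw]
        ring
      have h2 : ∀ x, {q : ℝ × ℝ | q.2 ∈ Set.uIoc c q.1}.indicator
          (fun q => ENNReal.ofReal (q.1 ^ ((j : ℕ) + (ν - 1)) * Real.exp (-q.1)) * ‖w q.2‖ₑ) (y, x) =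
          (Set.uIoc c y).indicator (fun x =>
            ENNReal.ofReal (y ^ ((j : ℕ) + (ν - 1)) * Real.exp (-y)) * ‖w x‖ₑ) x := fun x => by
        simp [Set.indicator]
      simp only [h2]
      rw [lintegral_indicator measurableSet_uIoc, Measure.restrict_restrict measurableSet_uIoc,
        Set.inter_eq_left.2 hsub, lintegral_const_mul' _ _ ENNReal.ofReal_ne_top, h1, enorm_mul,
        Real.enorm_of_nonneg (by positivity)]
      gcongr
      rw [← enorm_norm, intervalIntegral.norm_intervalIntegral_eq, enorm_norm]
      exact enorm_integral_le_lintegral_enorm _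
    refine lt_of_le_of_lt (setLIntegral_mono' measurableSet_Ioi hb) ?_
    rw [lintegral_lintegral_swap (f := fun y x => {q : ℝ × ℝ | q.2 ∈ Set.uIoc c q.1}.indicator
          (fun q => ENNReal.ofReal (q.1 ^ ((j : ℕ) + (ν - 1)) * Real.exp (-q.1)) * ‖w q.2‖ₑ) (y, x))]
    · have hb2 : ∀ x ∈ Set.Ioi (0 : ℝ), ∫⁻ y in Set.Ioi 0, {q : ℝ × ℝ | q.2 ∈ Set.uIoc c q.1}.indicator
          (fun q => ENNReal.ofReal (q.1 ^ ((j : ℕ) + (ν - 1)) * Real.exp (-q.1)) * ‖w q.2‖ₑ) (y, x) ≤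
          C * (‖f k x‖ₑ + ‖x ^ ((j : ℕ) - 1) * f k x‖ₑ) := by
        intro x hx
        have hx : 0 < x := hx
        have hRx : MeasurableSet {y : ℝ | x ∈ Set.uIoc c y} := measurable_prodMk_right hR
        have h2 : ∀ y, {q : ℝ × ℝ | q.2 ∈ Set.uIoc c q.1}.indicator
            (fun q => ENNReal.ofReal (q.1 ^ ((j : ℕ) + (ν - 1)) * Real.exp (-q.1)) * ‖w q.2‖ₑ) (y, x) =
            {y : ℝ | x ∈ Set.uIoc c y}.indicator (fun y =>
              ENNReal.ofReal (y ^ ((j : ℕ) + (ν - 1)) * Real.exp (-y)) * ‖w x‖ₑ) y := fun y => by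
          simp [Set.indicator]
        simp only [h2]
        rw [lintegral_indicator hRx, Measure.restrict_restrict hRx, Set.inter_comm,
          lintegral_mul_const _ (by fun_prop), hw]
        simp only
        rw [enorm_mul, Real.enorm_of_nonneg (by positivity), mul_comm, mul_right_comm]
        refine (mul_le_mul_left (hCle x hx) _).trans (le_of_eq ?_)
        have hxj : 0 ≤ x ^ ((j : ℕ) - 1) := by positivity
        rw [enorm_mul, Real.enorm_of_nonneg hxj, mul_assoc,
          ENNReal.ofReal_add zero_le_one (by positivity), ENNReal.ofReal_one, add_mul, one_mul]
      refine lt_of_le_of_lt (setLIntegral_mono' measurableSet_Ioi hb2) ?_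
      rw [lintegral_const_mul' _ _ hC, lintegral_add_left' hfm]
      refine ENNReal.mul_lt_top hC.lt_top (ENNReal.add_lt_top.2 ⟨(hf0 k).2, ?_⟩)
      have hj : (j : ℕ) - 1 < n := by have := j.2; have := k.pos; omega
      exact (hf ⟨_, hj⟩ k).2
    · change AEMeasurable ({q : ℝ × ℝ | q.2 ∈ Set.uIoc c q.1}.indicator
        (fun q => ENNReal.ofReal (q.1 ^ ((j : ℕ) + (ν - 1)) * Real.exp (-q.1)) * ‖w q.2‖ₑ)) _
      have hm : Measurable fun q : ℝ × ℝ =>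
          ENNReal.ofReal (q.1 ^ ((j : ℕ) + (ν - 1)) * Real.exp (-q.1)) := by fun_prop
      exact (hm.aemeasurable.mul hwm.comp_snd).indicator hR

end Integrability

-- Averaging the conditional law over the random matrix.

section RankOnePerturbation

variable {n ν : ℕ} {c Z : ℝ} {f : Fin n → ℝ → ℝ}

/-- The joint density kernel of the ordered eigenvalues before and after the modification. -/
noncomputable def orderedKernel (ν : ℕ) {n : ℕ} (B : Set (Fin (n + 1) → ℝ))
    (q : (Fin n → ℝ) × (Fin (n + 1) → ℝ)) : ENNReal :=
  {q : (Fin n → ℝ) × (Fin (n + 1) → ℝ) | q.1 ∈ orderedPositive n ∧ q.2 ∈ B ∧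
    Interlaces (Fin.cons 0 q.1 : Fin (n + 1) → ℝ) q.2}.indicator
    (fun q => ENNReal.ofReal (rankOneKernel ν q.1 q.2)) q

theorem measurable_cons_zero : Measurable fun x : Fin n → ℝ => (Fin.cons 0 x : Fin (n + 1) → ℝ) := by
  refine measurable_pi_lambda _ (Fin.cases ?_ fun j => ?_)
  · simp only [Fin.cons_zero]; exact measurable_const
  · simp only [Fin.cons_succ]; exact measurable_pi_apply j

theorem measurable_orderedKernel {B : Set (Fin (n + 1) → ℝ)} (hB : MeasurableSet B) :
    Measurable (orderedKernel ν B) := by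
  have hcons := measurable_cons_zero (n := n)
  refine Measurable.indicator ?_ ?_
  · have h1 : Measurable fun q : (Fin n → ℝ) × (Fin (n + 1) → ℝ) => vandermondeProd q.2 :=
      measurable_vandermondeProd.comp measurable_snd
    have h2 : Measurable fun q : (Fin n → ℝ) × (Fin (n + 1) → ℝ) =>
        vandermondeProd (Fin.cons 0 q.1 : Fin (n + 1) → ℝ) :=
      measurable_vandermondeProd.comp (hcons.comp measurable_fst)
    unfold rankOneKernel
    refine Measurable.ennreal_ofReal ((h1.div h2).mul ?_)
    fun_prop
  · exact (measurable_fst (measurableSet_orderedPositive n)).inter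
      ((measurable_snd hB).inter
        (((hcons.comp measurable_fst).prodMk measurable_snd) (measurableSet_interlaces (n + 1))))

theorem lintegral_orderedKernel {B : Set (Fin (n + 1) → ℝ)} (hB : MeasurableSet B)
    {x : Fin n → ℝ} (hx : x ∈ orderedPositive n) :
    ∫⁻ y, orderedKernel ν B (x, y) =
      ∫⁻ y in B ∩ {y | Interlaces (Fin.cons 0 x : Fin (n + 1) → ℝ) y},
        ENNReal.ofReal (rankOneKernel ν x y) := by
  have hI : MeasurableSet (B ∩ {y | Interlaces (Fin.cons 0 x : Fin (n + 1) → ℝ) y}) :=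
    hB.inter (measurable_prodMk_left (measurableSet_interlaces (n + 1)))
  rw [← lintegral_indicator hI]
  refine lintegral_congr fun y => ?_
  by_cases hy : y ∈ B ∩ {y | Interlaces (Fin.cons 0 x : Fin (n + 1) → ℝ) y}
  · rw [Set.indicator_of_mem hy, orderedKernel, Set.indicator_of_mem (by exact ⟨hx, hy.1, hy.2⟩)]
  · rw [Set.indicator_of_notMem hy, orderedKernel,
      Set.indicator_of_notMem (by exact fun h => hy ⟨h.2.1, h.2.2⟩)]

/-- For y in B, ordered and positive, the kernel restricts x to the interlacing box; for any other y
it vanishes. -/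
theorem setLIntegral_orderedKernel_mul (hν : 1 ≤ ν) (hc : 0 < c)
    (hf : ∀ k, IntegrableOn (f k) (Set.Ioi 0))
    (hP : ∀ x : Fin n → ℝ, (∀ j, 0 < x j) → 0 ≤ polyEnsembleDensity Z f x)
    (B : Set (Fin (n + 1) → ℝ)) (y : Fin (n + 1) → ℝ) :
    ∫⁻ x in {x : Fin n → ℝ | ∀ j, 0 < x j},
      orderedKernel ν B (x, y) * ENNReal.ofReal (polyEnsembleDensity Z f x) =
      ((n + 1 : ℕ) : ENNReal) * (B ∩ orderedPositive (n + 1)).indicator (fun y => ENNReal.ofReal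
        (polyEnsembleDensity (Z * (ν - 1).factorial * (n + 1)) (rankOneFunctions ν c f) y)) y := by
  by_cases hy : y ∈ B ∩ orderedPositive (n + 1)
  · rw [Set.indicator_of_mem hy, ← (setLIntegral_rankOneKernel_mul hν hc hf hP hy.2).2,
      ← lintegral_indicator (MeasurableSet.univ_pi fun _ => measurableSet_Ioo),
      ← lintegral_indicator (measurableSet_forall_pos n)]
    refine lintegral_congr fun x => ?_
    have hiff := mem_orderedPositive_and_interlaces_iff (x := x) hy.2
    by_cases hx : x ∈ Set.univ.pi fun j : Fin n => Set.Ioo (y j.castSucc) (y j.succ)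
    · obtain ⟨hxo, hxI⟩ := hiff.2 hx
      rw [Set.indicator_of_mem hx, Set.indicator_of_mem (by exact hxo.2), orderedKernel,
        Set.indicator_of_mem (by exact ⟨hxo, hy.1, hxI⟩)]
    · rw [Set.indicator_of_notMem hx]
      refine Set.indicator_apply_eq_zero.2 fun _ => ?_
      rw [orderedKernel, Set.indicator_of_notMem, zero_mul]
      exact fun h => hx (hiff.1 ⟨h.1, h.2.2⟩)
  · rw [Set.indicator_of_notMem hy, mul_zero]
    refine (lintegral_congr fun x => ?_).trans lintegral_zero
    rw [orderedKernel, Set.indicator_of_notMem, zero_mul]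
    rintro ⟨h1, h2, h3⟩
    exact hy ⟨h2, h3.mem_orderedPositive h1⟩

variable {Ω : Type*} [MeasurableSpace Ω] {μ : Measure Ω}
  {X : Ω → Matrix (Fin (n + ν)) (Fin (n + ν)) ℂ} {v : Ω → Fin (n + ν) → ℂ}

theorem IsStdComplexGaussianVector.aemeasurable {m : ℕ} {v : Ω → Fin m → ℂ}
    (hv : IsStdComplexGaussianVector μ v) : AEMeasurable v μ :=
  aemeasurable_pi_lambda _ fun j =>
    aemeasurable_of_re_im (hv.1 j).aemeasurable (hv.2.1 j).aemeasurable

theorem measurableSet_hasSpectrumIn_prod {B : Set (Fin (n + 1) → ℝ)} (hB : MeasurableSet B) :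
    MeasurableSet {q : (Fin (n + ν) × Fin (n + ν) → ℂ) × (Fin (n + ν) → ℂ) |
      HasSpectrumIn ν B (rankOneModification (Matrix.of fun i j => q.1 (i, j)) q.2)} := by
  refine measurableSet_hasSpectrumIn ν hB fun i j => ?_
  simp only [rankOneModification, Matrix.add_apply, Matrix.of_apply, Matrix.vecMulVec_apply,
    Pi.star_apply]
  fun_prop

theorem nullMeasurableSet_hasSpectrumIn (hX : ∀ i j, AEMeasurable (fun ω => X ω i j) μ)
    (hv : IsStdComplexGaussianVector μ v) {B : Set (Fin (n + 1) → ℝ)} (hB : MeasurableSet B) :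
    NullMeasurableSet {ω | HasSpectrumIn ν B (rankOneModification (X ω) (v ω))} μ :=
  ((aemeasurable_pi_lambda (fun ω (p : Fin (n + ν) × Fin (n + ν)) => X ω p.1 p.2)
    fun p => hX p.1 p.2).prodMk hv.aemeasurable).nullMeasurableSet_preimage
      (measurableSet_hasSpectrumIn_prod hB)

theorem ae_exists_orderedPositive
    (hcard : ∀ᵐ ω ∂μ, (posEigenvalues (X ω)).card = n)
    (hdens : HasUnorderedDensity μ (Set.Ioi 0) (fun ω => posEigenvalues (X ω))
      (polyEnsembleDensity Z f)) :
    ∀ᵐ ω ∂μ, ∃ x ∈ orderedPositive n,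
      (Finset.univ : Finset (Fin n)).val.map x = posEigenvalues (X ω) := by
  filter_upwards [hdens.ae_exists_strictMono (measurableSet_forall_pos n)
    (fun x hx => polyEnsembleDensity_eq_zero Z f hx) hcard] with ω hω
  obtain ⟨x, hx, hxM⟩ := hω
  refine ⟨x, ⟨hx, fun i => ?_⟩, hxM⟩
  have hi : x i ∈ posEigenvalues (X ω) := by
    rw [← hxM]; exact Multiset.mem_map_of_mem x (Finset.mem_univ_val i)
  rw [posEigenvalues, Multiset.mem_map] at hi
  obtain ⟨z, hz, hzi⟩ := hi
  rw [← hzi]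
  exact (Multiset.mem_filter.1 hz).2.1

theorem measure_prodMk_mem_eq_lintegral {α β : Type*} [MeasurableSpace α] [MeasurableSpace β]
    [IsProbabilityMeasure μ] {U : Ω → α} {V : Ω → β} (hU : AEMeasurable U μ)
    (hV : AEMeasurable V μ) (h : IndepFun U V μ) {E : Set (α × β)} (hE : MeasurableSet E) :
    AEMeasurable (fun ω => (μ.map V) (Prod.mk (U ω) ⁻¹' E)) μ ∧
      μ {ω | (U ω, V ω) ∈ E} = ∫⁻ ω, (μ.map V) (Prod.mk (U ω) ⁻¹' E) ∂μ := by
  have hlaw := (indepFun_iff_map_prod_eq_prod_map_map hU hV).1 h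
  have := Measure.isProbabilityMeasure_map hV
  have hsec : Measurable fun a => (μ.map V) (Prod.mk a ⁻¹' E) := measurable_measure_prodMk_left hE
  refine ⟨hsec.comp_aemeasurable hU, ?_⟩
  have h1 := Measure.map_apply_of_aemeasurable (hU.prodMk hV) hE
  rw [hlaw, Measure.prod_apply hE, lintegral_map' hsec.aemeasurable hU] at h1
  exact h1.symm

variable [IsProbabilityMeasure μ]

/-- By independence and Fubini, X may be frozen while the Gaussian vector is integrated out. -/
theorem measure_hasSpectrumIn_eq_lintegral (hX : ∀ i j, AEMeasurable (fun ω => X ω i j) μ)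
    (hv : IsStdComplexGaussianVector μ v)
    (hXv : IndepFun (fun ω (p : Fin (n + ν) × Fin (n + ν)) => X ω p.1 p.2) v μ)
    {B : Set (Fin (n + 1) → ℝ)} (hB : MeasurableSet B) :
    AEMeasurable (fun ω => (Measure.pi fun _ => complexGaussian)
      {w | HasSpectrumIn ν B (rankOneModification (X ω) w)}) μ ∧
    μ {ω | HasSpectrumIn ν B (rankOneModification (X ω) (v ω))} =
      ∫⁻ ω, (Measure.pi fun _ => complexGaussian)
        {w | HasSpectrumIn ν B (rankOneModification (X ω) w)} ∂μ := by
  have h := measure_prodMk_mem_eq_lintegral (aemeasurable_pi_lambda _ fun p => hX p.1 p.2)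
    hv.aemeasurable hXv (measurableSet_hasSpectrumIn_prod (n := n) (ν := ν) hB)
  rw [hv.map_eq] at h
  exact h

theorem ae_hasSpectrumIn_rankOneModification (hν : 1 ≤ ν)
    (hX : ∀ i j, AEMeasurable (fun ω => X ω i j) μ) (hv : IsStdComplexGaussianVector μ v)
    (hXv : IndepFun (fun ω (p : Fin (n + ν) × Fin (n + ν)) => X ω p.1 p.2) v μ)
    (hpsd : ∀ᵐ ω ∂μ, (X ω).PosSemidef)
    (hcard : ∀ᵐ ω ∂μ, (posEigenvalues (X ω)).card = n)
    (hdens : HasUnorderedDensity μ (Set.Ioi 0) (fun ω => posEigenvalues (X ω))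
      (polyEnsembleDensity Z f)) :
    ∀ᵐ ω ∂μ, HasSpectrumIn ν (Set.univ : Set (Fin (n + 1) → ℝ))
      (rankOneModification (X ω) (v ω)) := by
  refine (mem_ae_iff_prob_eq_one₀ (nullMeasurableSet_hasSpectrumIn hX hv MeasurableSet.univ)).2 ?_
  rw [(measure_hasSpectrumIn_eq_lintegral hX hv hXv MeasurableSet.univ).2,
    lintegral_congr_ae (g := fun _ => 1), lintegral_one, measure_univ]
  filter_upwards [hpsd, ae_exists_orderedPositive hcard hdens] with ω hA hω
  obtain ⟨x, hx, hxA⟩ := hω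
  rw [measure_congr (Filter.eventuallyEq_univ.2 (ae_hasSpectrumIn_univ hν hA hx hxA)), measure_univ]

theorem measure_hasSpectrumIn_eq_setLIntegral (hν : 1 ≤ ν) (hc : 0 < c)
    (hX : ∀ i j, AEMeasurable (fun ω => X ω i j) μ) (hv : IsStdComplexGaussianVector μ v)
    (hXv : IndepFun (fun ω (p : Fin (n + ν) × Fin (n + ν)) => X ω p.1 p.2) v μ)
    (hpsd : ∀ᵐ ω ∂μ, (X ω).PosSemidef)
    (hcard : ∀ᵐ ω ∂μ, (posEigenvalues (X ω)).card = n)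
    (hf : ∀ k, IntegrableOn (f k) (Set.Ioi 0))
    (hP : ∀ x : Fin n → ℝ, (∀ j, 0 < x j) → 0 ≤ polyEnsembleDensity Z f x)
    (hdens : HasUnorderedDensity μ (Set.Ioi 0) (fun ω => posEigenvalues (X ω))
      (polyEnsembleDensity Z f)) {B : Set (Fin (n + 1) → ℝ)} (hB : MeasurableSet B) :
    μ {ω | HasSpectrumIn ν B (rankOneModification (X ω) (v ω))} =
      (n + 1).factorial * ∫⁻ y in B ∩ orderedPositive (n + 1), ENNReal.ofReal
        (polyEnsembleDensity (Z * (ν - 1).factorial * (n + 1)) (rankOneFunctions ν c f) y) := by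
  obtain ⟨hGm, hG⟩ := measure_hasSpectrumIn_eq_lintegral hX hv hXv hB
  have hH := measurable_orderedKernel (n := n) (ν := ν) hB
  set g : (Fin n → ℝ) → ENNReal := fun x => ∫⁻ y, orderedKernel ν B (x, y) with hg
  have hgm : Measurable g := hH.lintegral_prod_right'
  have hg0 : ∀ x, ¬ StrictMono x → g x = 0 := fun x hx => by
    refine (lintegral_congr fun y => ?_).trans lintegral_zero
    exact Set.indicator_of_notMem (fun h => hx h.1.1) _
  have hPm : AEMeasurable (polyEnsembleDensity Z f)
      (volume.restrict {x : Fin n → ℝ | ∀ j, x j ∈ Set.Ioi (0 : ℝ)}) :=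
    aemeasurable_polyEnsembleDensity Z fun k => (hf k).1.aemeasurable
  have hTs : ∀ (σ : Equiv.Perm (Fin n)) (x : Fin n → ℝ),
      x ∈ {x : Fin n → ℝ | ∀ j, x j ∈ Set.Ioi (0 : ℝ)} ↔
        x ∘ σ ∈ {x : Fin n → ℝ | ∀ j, x j ∈ Set.Ioi (0 : ℝ)} := fun σ x =>
    ⟨fun h j => h (σ j), fun h j => by simpa using h (σ.symm j)⟩
  -- The conditional probability g is supported on ordered x, so it is symmetrized before being
  -- tested against the unordered density; at an ordered x only the identity contributes.
  have hsum := hdens.lintegral_eq hPm (F := fun x => ∑ σ : Equiv.Perm (Fin n), g (x ∘ σ))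
    (Finset.measurable_sum _ fun σ _ => hgm.comp (measurePreserving_comp_perm σ).measurable)
    (fun τ x => Fintype.sum_equiv (Equiv.mulLeft τ) _ _ fun σ => rfl) hGm (by
      filter_upwards [hpsd, ae_exists_orderedPositive hcard hdens] with ω hA hω
      obtain ⟨x, hx, hxA⟩ := hω
      refine ⟨x, hxA, ?_⟩
      rw [pi_complexGaussian_hasSpectrumIn hν hA hx hxA hB, ← lintegral_orderedKernel hB hx]
      exact (sum_perm_eq_single (σ := 1) hg0 hx.1).symm)
  rw [hG, hsum, setLIntegral_sum_perm_mul hTs hgm hPm.ennreal_ofReal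
    (fun σ x => by rw [polyEnsembleDensity_comp_perm])]
  have hswap : ∫⁻ x in {x : Fin n → ℝ | ∀ j, x j ∈ Set.Ioi (0 : ℝ)},
      g x * ENNReal.ofReal (polyEnsembleDensity Z f x) =
      ∫⁻ y, ∫⁻ x in {x : Fin n → ℝ | ∀ j, 0 < x j},
        orderedKernel ν B (x, y) * ENNReal.ofReal (polyEnsembleDensity Z f x) := by
    change _ = ∫⁻ y, ∫⁻ x in {x : Fin n → ℝ | ∀ j, x j ∈ Set.Ioi (0 : ℝ)}, _
    rw [← lintegral_lintegral_swap (hH.aemeasurable.mul hPm.ennreal_ofReal.comp_fst)]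
    refine lintegral_congr fun x => ?_
    exact (lintegral_mul_const' _ _ ENNReal.ofReal_ne_top).symm
  rw [hswap, lintegral_congr fun y => setLIntegral_orderedKernel_mul hν hc hf hP B y,
    lintegral_const_mul' _ _ (ENNReal.natCast_ne_top _),
    lintegral_indicator (hB.inter (measurableSet_orderedPositive _)), ← mul_assoc]
  congr 1
  -- The n! comes from symmetrizing in x and the n + 1 from the box integral.
  rw [Nat.factorial_succ]
  push_cast
  ring

end RankOnePerturbation

-- Assembly of the theorem.

theorem proposition5p2 {Ω : Type*} [MeasurableSpace Ω] (μ : Measure Ω) [IsProbabilityMeasure μ]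
    (n ν : ℕ) (hn : 1 ≤ n) (hν : 1 ≤ ν)
    (X : Ω → Matrix (Fin (n + ν)) (Fin (n + ν)) ℂ) (v : Ω → Fin (n + ν) → ℂ)
    (f : Fin n → ℝ → ℝ) (c : ℝ) (hc : 0 < c)
    (hX : ∀ i j, AEMeasurable (fun ω => X ω i j) μ)
    (hv : IsStdComplexGaussianVector μ v)
    (hXv : IndepFun (fun ω (p : Fin (n + ν) × Fin (n + ν)) => X ω p.1 p.2) v μ)
    (hpsd : ∀ᵐ ω ∂μ, (X ω).PosSemidef)
    (hcard : ∀ᵐ ω ∂μ, (posEigenvalues (X ω)).card = n)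
    (hens : IsPolynomialEnsemble μ (Set.Ioi 0) f (fun ω => posEigenvalues (X ω))) :
    (∀ᵐ ω ∂μ,
      (rankOneModification (X ω) (v ω)).charpoly.rootMultiplicity 0 = ν - 1 ∧
      (posEigenvalues (rankOneModification (X ω) (v ω))).card = n + 1) ∧
    (∀ k : Fin n, ∀ y : ℝ, 0 < y →
      IntervalIntegrable (fun x : ℝ => x ^ (-(ν : ℤ)) * Real.exp x * f k x) volume c y) ∧
    IsPolynomialEnsemble μ (Set.Ioi 0) (rankOneFunctions ν c f)
      (fun ω => posEigenvalues (rankOneModification (X ω) (v ω))) := by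
  obtain ⟨hint, Z, hP, -, hdens⟩ := hens
  -- The zeroth moment; the index 0 exists because n ≥ 1.
  have hf : ∀ k, IntegrableOn (f k) (Set.Ioi 0) := fun k => by
    simpa using hint ⟨0, hn⟩ k
  have hspec := ae_hasSpectrumIn_rankOneModification hν hX hv hXv hpsd hcard hdens
  have hfirst : ∀ᵐ ω ∂μ,
      (rankOneModification (X ω) (v ω)).charpoly.rootMultiplicity 0 = ν - 1 ∧
      (posEigenvalues (rankOneModification (X ω) (v ω))).card = n + 1 := by
    filter_upwards [hspec] with ω hω
    obtain ⟨y, ⟨-, hy⟩, h⟩ := hω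
    refine ⟨rootMultiplicity_zero_of_charpoly_eq hy.2 h, ?_⟩
    rw [posEigenvalues_of_charpoly_eq hy.2 h]
    simp
  have hdens' : HasUnorderedDensity μ (Set.Ioi 0)
      (fun ω => posEigenvalues (rankOneModification (X ω) (v ω)))
      (polyEnsembleDensity (Z * (ν - 1).factorial * (n + 1)) (rankOneFunctions ν c f)) := by
    intro B hB hBs
    -- Since B is permutation invariant, it does not matter in which order the eigenvalues are
    -- listed.
    have hev : ({ω | ∃ y ∈ B, (Finset.univ : Finset (Fin (n + 1))).val.map y =
        posEigenvalues (rankOneModification (X ω) (v ω))} : Set Ω) =ᵐ[μ]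
        {ω | HasSpectrumIn ν B (rankOneModification (X ω) (v ω))} := by
      filter_upwards [hspec] with ω hω
      obtain ⟨z, ⟨-, hz⟩, h⟩ := hω
      have hpos := posEigenvalues_of_charpoly_eq hz.2 h
      refine propext ⟨?_, ?_⟩
      · rintro ⟨y, hy, hyM⟩
        obtain ⟨σ, rfl⟩ := exists_perm_of_map_eq (hpos.symm.trans hyM.symm)
        exact ⟨_, ⟨hBs σ y hy, hz⟩, h⟩
      · rintro ⟨y, ⟨hyB, hy⟩, hy'⟩
        exact ⟨y, hyB, (posEigenvalues_of_charpoly_eq hy.2 hy').symm⟩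
    have hT : ∀ (σ : Equiv.Perm (Fin (n + 1))) (y : Fin (n + 1) → ℝ),
        y ∈ B ∩ {y | ∀ j, y j ∈ Set.Ioi (0 : ℝ)} ↔
          y ∘ σ ∈ B ∩ {y | ∀ j, y j ∈ Set.Ioi (0 : ℝ)} := fun σ y => by
      refine ⟨fun h => ⟨hBs σ y h.1, fun j => h.2 (σ j)⟩, fun h => ⟨?_, fun j => ?_⟩⟩
      · have := hBs σ.symm _ h.1
        rwa [Function.comp_assoc, Equiv.self_comp_symm, Function.comp_id] at this
      · simpa using h.2 (σ.symm j)
    have hQ : AEMeasurable (polyEnsembleDensity (Z * (ν - 1).factorial * (n + 1))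
        (rankOneFunctions ν c f)) (volume.restrict {y | ∀ j, y j ∈ Set.Ioi (0 : ℝ)}) :=
      aemeasurable_polyEnsembleDensity _ fun k =>
        (continuousOn_rankOneFunctions hc hf k).aemeasurable measurableSet_Ioi
    have hset : B ∩ {y : Fin (n + 1) → ℝ | ∀ j, y j ∈ Set.Ioi (0 : ℝ)} ∩ {y | StrictMono y} =
        B ∩ orderedPositive (n + 1) := by
      rw [Set.inter_assoc]
      congr 1
      ext y
      exact and_comm
    rw [measure_congr hev, measure_hasSpectrumIn_eq_setLIntegral hν hc hX hv hXv hpsd hcard hf hP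
      hdens hB, setLIntegral_eq_factorial_mul hT
        (hQ.mono_measure (Measure.restrict_mono Set.inter_subset_right le_rfl)).ennreal_ofReal
        (fun σ y => by rw [polyEnsembleDensity_comp_perm])
        (fun y hy => by rw [polyEnsembleDensity_eq_zero _ _ hy, ENNReal.ofReal_zero]), hset]
  refine ⟨hfirst, fun k y hy => intervalIntegrable_rankOne_integrand hf k hc hy,
    integrableOn_pow_mul_rankOneFunctions hν hc hint hf, _,
    fun y hy => polyEnsembleDensity_rankOne_nonneg hν hc hf hP hy, ?_, hdens'⟩
  -- The total mass is the probability that the positive eigenvalues form an (n+1)-tuple, which is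
  -- almost sure, so no normalization integral is computed.
  have h := hdens' Set.univ MeasurableSet.univ (fun _ _ _ => Set.mem_univ _)
  rw [Set.univ_inter] at h
  rw [← h, measure_congr (Filter.eventuallyEq_univ.2 ?_), measure_univ]
  filter_upwards [hspec] with ω hω
  obtain ⟨y, ⟨-, hy⟩, hy'⟩ := hω
  exact ⟨y, Set.mem_univ y, (posEigenvalues_of_charpoly_eq hy.2 hy').symm⟩
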